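/- Let $n\ge 2$ be an integer, $\kappa>0$, $\lambda>0$, and let $h:(0,\infty)\to[0,\infty)$ be a $C^1$ function, twice differentiable, with $h''(d)>0$ for all $d>0$ and $$\lim_{d\to0^+}h(d)=\infty,\quad \lim_{d\to\infty}\frac{h(d)}{d}=\infty,\quad \lim_{d\to0^+}h'(d)=-\infty,\quad \lim_{d\to\infty}h'(d)=\infty .$$ Assume that there are constants $K,\gamma_0>0$ such that $$|d\,h'(cd)|\le K\,[h(d)+1]\qquad\text{for all } d>0 \text{ and all } c>0 \text{ with } |c-1|\le\gamma_0 .$$ Let $$\Phi(v_1,\dots,v_n)=\frac{\kappa}{n}\sum_{i=1}^n v_i^n+h(v_1v_2\cdots v_n),\qquad v_1,\dots,v_n>0 ,$$ let $$\mathcal A_\lambda=\{r\in W^{1,1}(0,1): r(1)=\lambda,\ r'(R)>0 \text{ for a.e. } R\in(0,1),\ r(0)\ge0\}$$ (where $r$ is identified with its continuous representative on $[0,1]$), and for $r\in\mathcal A_\lambda$ let $$\hat I(r)=\int_0^1R^{n-1}\Big[\frac{\kappa}{n}(r')^n+h(\delta)+\kappa(n-1)\,\delta\Big(\frac1n+\ln\frac{r}{R}\Big)\Big]\,dR-\frac{\kappa(n-1)}{n}\lambda^n\ln\lambda,\qquad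 \delta(R)=r'(R)\Big(\frac{r(R)}{R}\Big)^{n-1},$$ which takes values in $(-\infty,\infty]$. Let $r$ be any minimizer of $\hat I$ over $\mathcal A_\lambda$. Then $r$ is a classical solution of the radial equilibrium equation for the stored energy $\Phi$: $r\in C^1((0,1])$, $r(R)>0$ and $r'(R)>0$ for all $R\in(0,1]$, the function $R\mapsto R^{n-1}\Phi_{,1}(r(R))$ is $C^1$ on $(0,1]$, and $$\frac{d}{dR}\left[R^{n-1}\Phi_{,1}(r(R))\right]=(n-1)R^{n-2}\,\Phi_{,2}(r(R)),\qquad 0<R<1,$$ where $\Phi_{,i}=\partial\Phi/\partial v_i$ and $\Phi_{,i}(r(R))=\Phi_{,i}\big(r'(R),\tfrac{r(R)}{R},\dots,\tfrac{r(R)}{R}\big)$. -/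

import Mathlib

open MeasureTheory Set Filter
open scoped Topology ENNReal ContDiff

noncomputable section

namespace Cavitation

/-- `g ∈ L¹(0,1)` is a weak (distributional) derivative of `r` on the interval `(0,1)`. -/
def IsWeakDeriv (r g : ℝ → ℝ) : Prop :=
  IntegrableOn g (Ioo 0 1) ∧
    ∀ φ : ℝ → ℝ, ContDiff ℝ ∞ φ → HasCompactSupport φ → tsupport φ ⊆ Ioo 0 1 →
      ∫ x in Ioo (0 : ℝ) 1, r x * deriv φ x = - ∫ x in Ioo (0 : ℝ) 1, g x * φ x

/-- `r ∈ W^{1,1}(0,1)`, where `r` is the representative that is continuous on `[0,1]`, so that the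
boundary values `r 0` and `r 1` make sense. -/
def MemW11 (r : ℝ → ℝ) : Prop :=
  ContinuousOn r (Icc 0 1) ∧ ∃ g, IsWeakDeriv r g

open Classical in
/-- The weak derivative of `r` on `(0,1)` (unique up to a null set). -/
def weakDeriv (r : ℝ → ℝ) : ℝ → ℝ :=
  if hr : ∃ g, IsWeakDeriv r g then hr.choose else 0

/-- The admissible set `𝒜_λ`. -/
def Admissible (lam : ℝ) : Set (ℝ → ℝ) :=
  {r | MemW11 r ∧ r 1 = lam ∧ (∀ᵐ R ∂volume.restrict (Ioo (0 : ℝ) 1), 0 < weakDeriv r R) ∧ 0 ≤ r 0}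

/-- The assumptions on `h : (0,∞) → [0,∞)`; the values of `h` outside `(0,∞)` play no role. -/
structure IsVolumetricEnergy (h : ℝ → ℝ) : Prop where
  nonneg : ∀ d > 0, 0 ≤ h d
  contDiffOn : ContDiffOn ℝ 1 h (Ioi 0)
  differentiableAt_deriv : ∀ d > 0, DifferentiableAt ℝ (deriv h) d
  deriv_deriv_pos : ∀ d > 0, 0 < deriv (deriv h) d
  tendsto_zero : Tendsto h (𝓝[>] 0) atTop
  tendsto_div_atTop : Tendsto (fun d => h d / d) atTop atTop
  tendsto_deriv_zero : Tendsto (deriv h) (𝓝[>] 0) atBot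
  tendsto_deriv_atTop : Tendsto (deriv h) atTop atTop

/-- `|d h'(c d)| ≤ K (h(d) + 1)` whenever `|c - 1| ≤ γ₀`, for some positive `K`, `γ₀`. -/
def DerivGrowth (h : ℝ → ℝ) : Prop :=
  ∃ K > 0, ∃ γ₀ > 0, ∀ d > 0, ∀ c > 0, |c - 1| ≤ γ₀ → |d * deriv h (c * d)| ≤ K * (h d + 1)

/-- The stored energy `Φ(v₁,…,vₙ) = (κ/n) ∑ vᵢⁿ + h(v₁⋯vₙ)` as a function of the stretches. -/
def storedEnergy (n : ℕ) (κ : ℝ) (h : ℝ → ℝ) (v : Fin n → ℝ) : ℝ :=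
  κ / n * ∑ i, v i ^ n + h (∏ i, v i)

/-- The partial derivative `Φ_{,i}` at `v`. -/
def partialDeriv {n : ℕ} (Φ : (Fin n → ℝ) → ℝ) (i : Fin n) (v : Fin n → ℝ) : ℝ :=
  deriv (fun t => Φ (Function.update v i t)) (v i)

/-- The vector of stretches `(q, t, …, t)`. -/
def radialStretches (n : ℕ) (q t : ℝ) : Fin n → ℝ :=
  fun i => if i.val = 0 then q else t

/-- The integrand of the modified functional at radius `R`, where `s = r(R)` and `q = r'(R)`;
here `δ = r' (r/R)^{n-1}`. -/
def modifiedDensity (n : ℕ) (κ : ℝ) (h : ℝ → ℝ) (R s q : ℝ) : ℝ :=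
  R ^ (n - 1) * (κ / n * q ^ n + h (q * (s / R) ^ (n - 1))
    + κ * ((n : ℝ) - 1) * (q * (s / R) ^ (n - 1)) * (1 / n + Real.log (s / R)))

/-- The modified energy functional `Î`, with values in the extended reals. The integral over `(0,1)`
is that of the positive part minus that of the negative part. -/
def modifiedEnergy (n : ℕ) (κ : ℝ) (h : ℝ → ℝ) (lam : ℝ) (r : ℝ → ℝ) : EReal :=
  ((∫⁻ R in Ioo (0 : ℝ) 1, ENNReal.ofReal (modifiedDensity n κ h R (r R) (weakDeriv r R)) : ℝ≥0∞)
      : EReal)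
    - ((∫⁻ R in Ioo (0 : ℝ) 1, ENNReal.ofReal (- modifiedDensity n κ h R (r R) (weakDeriv r R))
        : ℝ≥0∞) : EReal)
    - ((κ * ((n : ℝ) - 1) / n * lam ^ n * Real.log lam : ℝ) : EReal)

/-- The derivative of `r` on `(0,1]` (one-sided at `1`). -/
def rDeriv (r : ℝ → ℝ) (R : ℝ) : ℝ := derivWithin r (Ioc 0 1) R

/-- `Φ_{,i}(r(R)) = Φ_{,i}(r'(R), r(R)/R, …, r(R)/R)`. -/
def radialPartial {n : ℕ} (Φ : (Fin n → ℝ) → ℝ) (r : ℝ → ℝ) (i : Fin n) (R : ℝ) : ℝ :=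
  partialDeriv Φ i (radialStretches n (rDeriv r R) (r R / R))

/-- `r` is a (classical) solution of the radial equilibrium equation
`d/dR [R^{n-1} Φ_{,1}(r(R))] = (n-1) R^{n-2} Φ_{,2}(r(R))`, `0 < R < 1`: both `r` and
`R^{n-1} Φ_{,1}(r(R))` are `C¹` on `(0,1]`, the stretches `r'`, `r/R` are positive there, and the
equation holds at every point. -/
structure IsRadialEquilibrium {n : ℕ} (hn : 2 ≤ n) (Φ : (Fin n → ℝ) → ℝ) (r : ℝ → ℝ) : Prop where
  contDiffOn : ContDiffOn ℝ 1 r (Ioc 0 1)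
  pos : ∀ R ∈ Ioc (0 : ℝ) 1, 0 < r R
  deriv_pos : ∀ R ∈ Ioc (0 : ℝ) 1, 0 < rDeriv r R
  contDiffOn_flux :
    ContDiffOn ℝ 1 (fun R => R ^ (n - 1) * radialPartial Φ r ⟨0, by omega⟩ R) (Ioc 0 1)
  equation : ∀ R ∈ Ioo (0 : ℝ) 1,
    HasDerivAt (fun ρ => ρ ^ (n - 1) * radialPartial Φ r ⟨0, by omega⟩ ρ)
      (((n : ℝ) - 1) * R ^ (n - 2) * radialPartial Φ r ⟨1, by omega⟩ R) R

end Cavitation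

end

/-!
A minimizer `r` is a primitive of its weak derivative `g > 0`, and comparison with `R ↦ λ R` shows
that its energy density is integrable (`integrableOn_and_integral_le_of_isMinOn`): the logarithmic
term, the only one without a sign, is bounded below by `-C g`.

The regularity of `r` comes from variations that are multiplicative in the derivative. Replace `g`
by `g (1 + ε θ)` with `θ` bounded, `θ = 0` near the origin, and `∫ g θ = 0`. For small `ε` the new
derivative is positive and the boundary values are unchanged, so the new function is admissible
whatever the size of `g`. The change of `r` is at most a multiple of `ε r`, so the determinant `δ`
is multiplied by a factor `c` close to `1`, and the growth condition on `h'` bounds the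
`ε`-derivative of the density by an integrable function (`exists_abs_densityVariation_le`).
Differentiation under the integral gives the weak Euler-Lagrange equation
(`IsProfile.integral_densityVariation_eq_zero`). After an integration by parts, a du Bois-Reymond
argument for the measure `g dR` gives the integrated equation

  `momentum (R, r, g) = c + ∫ force (t, r, g) dt`   for almost every `R`

on each `(a, 1)` with `a > 0` (`IsProfile.exists_momentum_ae_eq`), where `momentum` and `force` are
the partial derivatives of the modified density in `r'` and in `r`.

The right side is continuous in `R`. As `h'` increases strictly from `-∞` to `∞`, the momentum is a
strictly increasing bijection from `q > 0` onto the line, so `g` agrees almost everywhere with a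
continuous positive function. Hence `r` is `C¹` and the integrated equation can be differentiated
(`IsProfile.exists_continuous_deriv`). The momentum differs from the radial stress
`R^{n-1} Φ_{,1}` only by `κ (n-1) r^{n-1} (1/n + log (r/R))`, which is now `C¹` as well; its
derivative turns the force into `(n-1) R^{n-2} Φ_{,2}`
(`isRadialEquilibrium_of_hasDerivWithinAt`).
-/

namespace Cavitation

/-! ### Weak derivatives on the unit interval -/

theorem deriv_primitive_ae_eq {g : ℝ → ℝ} {a b : ℝ} (hg : IntervalIntegrable g volume a b) :
    ∀ᵐ x, x ∈ uIcc a b → deriv (fun x => ∫ t in a..x, g t) x = g x := by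
  filter_upwards [hg.ae_hasDerivAt_integral] with x hx hxm
  exact (hx hxm a left_mem_uIcc).deriv

theorem integral_primitive_mul {f g : ℝ → ℝ} {a b : ℝ} (hf : IntervalIntegrable f volume a b)
    (hg : IntervalIntegrable g volume a b) :
    ∫ x in a..b, (∫ t in a..x, f t) * g x =
      (∫ t in a..b, f t) * (∫ t in a..b, g t) - ∫ x in a..b, f x * ∫ t in a..x, g t := by
  have hF := hf.absolutelyContinuousOnInterval_intervalIntegral (c := a) left_mem_uIcc
  have hG := hg.absolutelyContinuousOnInterval_intervalIntegral (c := a) left_mem_uIcc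
  have key := hF.integral_mul_deriv_eq_deriv_mul hG
  simp only [intervalIntegral.integral_same, zero_mul, sub_zero] at key
  rw [intervalIntegral.integral_congr_ae (g := fun x => (∫ t in a..x, f t) * g x),
    intervalIntegral.integral_congr_ae (f := fun x => deriv (fun x => ∫ t in a..x, f t) x * _)
      (g := fun x => f x * ∫ t in a..x, g t)] at key
  · exact key
  · filter_upwards [deriv_primitive_ae_eq hf] with x hx hxm
    rw [hx (uIoc_subset_uIcc hxm)]
  · filter_upwards [deriv_primitive_ae_eq hg] with x hx hxm
    rw [hx (uIoc_subset_uIcc hxm)]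

theorem setIntegral_Ioo_eq_intervalIntegral {a b : ℝ} (hab : a ≤ b) (f : ℝ → ℝ) :
    ∫ x in Ioo a b, f x = ∫ x in a..b, f x := by
  rw [intervalIntegral.integral_of_le hab, integral_Ioc_eq_integral_Ioo]

theorem intervalIntegrable_of_integrableOn_Ioo {g : ℝ → ℝ} {a b : ℝ} (hab : a ≤ b)
    (hg : IntegrableOn g (Ioo a b)) : IntervalIntegrable g volume a b := by
  rwa [intervalIntegrable_iff_integrableOn_Ioo_of_le hab]

/-- A primitive of an integrable function has that function as a weak derivative. -/
theorem IsWeakDeriv.of_eq_integral {r g : ℝ → ℝ} (hg : IntegrableOn g (Ioo 0 1)) (c : ℝ)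
    (h : ∀ x ∈ Icc (0 : ℝ) 1, r x = c + ∫ t in (0 : ℝ)..x, g t) : IsWeakDeriv r g := by
  refine ⟨hg, fun φ hφ _ hsupp => ?_⟩
  have hgi := intervalIntegrable_of_integrableOn_Ioo zero_le_one hg
  have hG := hgi.absolutelyContinuousOnInterval_intervalIntegral (c := 0) left_mem_uIcc
  have hφac : AbsolutelyContinuousOnInterval φ 0 1 :=
    (hφ.of_le (by exact_mod_cast le_top)).contDiffOn.absolutelyContinuousOnInterval
  have h0 : φ 0 = 0 := image_eq_zero_of_notMem_tsupport fun h => (hsupp h).1.false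
  have h1 : φ 1 = 0 := image_eq_zero_of_notMem_tsupport fun h => (hsupp h).2.false
  have hφi : IntervalIntegrable (deriv φ) volume 0 1 := hφac.intervalIntegrable_deriv
  have key := hG.integral_mul_deriv_eq_deriv_mul hφac
  have hc : ∫ x in (0 : ℝ)..1, deriv φ x = 0 := by
    rw [hφac.integral_deriv_eq_sub, h0, h1, sub_zero]
  rw [setIntegral_Ioo_eq_intervalIntegral zero_le_one,
    setIntegral_Ioo_eq_intervalIntegral zero_le_one,
    intervalIntegral.integral_congr (g := fun x => c * deriv φ x + (∫ t in (0 : ℝ)..x, g t) *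
      deriv φ x),
    intervalIntegral.integral_add (hφi.const_mul c) (hφi.continuousOn_mul hG.continuousOn),
    intervalIntegral.integral_const_mul, hc, key, h0, h1]
  · simp only [mul_zero, sub_zero, zero_sub, zero_add, neg_inj]
    apply intervalIntegral.integral_congr_ae
    filter_upwards [deriv_primitive_ae_eq hgi] with x hx hxm
    rw [hx (uIoc_subset_uIcc hxm)]
  · intro x hx
    rw [uIcc_of_le zero_le_one] at hx
    simp only [h x hx]
    ring

theorem IsWeakDeriv.ae_eq {r g g' : ℝ → ℝ} (h : IsWeakDeriv r g) (h' : IsWeakDeriv r g') :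
    g =ᵐ[volume.restrict (Ioo 0 1)] g' := by
  have hd : IntegrableOn (fun x => g x - g' x) (Ioo 0 1) := h.1.sub h'.1
  have := isOpen_Ioo.ae_eq_zero_of_integral_contDiff_smul_eq_zero
    (μ := volume) hd.locallyIntegrableOn fun φ hφ hc hs => by
      have e : ∀ k : ℝ → ℝ, ∫ x in Ioo (0 : ℝ) 1, k x * φ x = ∫ x, φ x • k x := fun k => by
        rw [setIntegral_eq_integral_of_forall_compl_eq_zero]
        · simp [mul_comm]
        · intro x hx
          rw [image_eq_zero_of_notMem_tsupport fun h => hx (hs h), mul_zero]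
      have b : ∀ k : ℝ → ℝ, IntegrableOn k (Ioo 0 1) →
          IntegrableOn (fun x => k x * φ x) (Ioo 0 1) := fun k hk => by
        obtain ⟨C, hC⟩ := hφ.continuous.bounded_above_of_compact_support hc
        exact hk.mul_bdd hφ.continuous.aestronglyMeasurable (ae_of_all _ hC)
      have h1 := h.2 φ hφ hc hs
      have h2 := h'.2 φ hφ hc hs
      rw [← e]
      simp only [sub_mul]
      rw [integral_sub (b g h.1) (b g' h'.1)]
      linarith
  rw [EventuallyEq, ae_restrict_iff' measurableSet_Ioo]
  filter_upwards [this] with x hx hxm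
  exact sub_eq_zero.1 (hx hxm)

/-- A smooth function with compact support in `(0,1)` and integral zero is the derivative of a
function of the same kind. -/
theorem exists_contDiff_deriv_eq {ψ : ℝ → ℝ} (hψ : ContDiff ℝ ∞ ψ)
    (hs : tsupport ψ ⊆ Ioo 0 1) (h0 : ∫ x in (0 : ℝ)..1, ψ x = 0) :
    ∃ φ : ℝ → ℝ, ContDiff ℝ ∞ φ ∧ HasCompactSupport φ ∧ tsupport φ ⊆ Ioo 0 1 ∧ deriv φ = ψ := by
  set φ : ℝ → ℝ := fun x => ∫ t in (0 : ℝ)..x, ψ t with hφ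
  have hd : ∀ x, HasDerivAt φ (ψ x) x := fun x =>
    hψ.continuous.integral_hasStrictDerivAt 0 x |>.hasDerivAt
  have hder : deriv φ = ψ := funext fun x => (hd x).deriv
  have hz : ∀ x ∉ Ioo (0 : ℝ) 1, ψ x = 0 := fun x hx =>
    image_eq_zero_of_notMem_tsupport fun h => hx (hs h)
  have hcpt : IsCompact (tsupport ψ) :=
    isCompact_Icc.of_isClosed_subset (isClosed_tsupport ψ) (hs.trans Ioo_subset_Icc_self)
  -- the support of `ψ` lies in some `[a, b]` inside `(0, 1)`, and `φ` vanishes outside `[a, b]`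
  obtain ⟨a, b, ha, hb, hab⟩ : ∃ a b : ℝ, 0 < a ∧ b < 1 ∧ tsupport ψ ⊆ Icc a b := by
    rcases (tsupport ψ).eq_empty_or_nonempty with he | hne
    · exact ⟨1, 0, one_pos, one_pos, by simp [he]⟩
    · obtain ⟨a, ha, ha'⟩ := hcpt.exists_isLeast hne
      obtain ⟨b, hb, hb'⟩ := hcpt.exists_isGreatest hne
      exact ⟨a, b, (hs ha).1, (hs hb).2, fun x hx => ⟨ha' hx, hb' hx⟩⟩
  have hz' : ∀ x ∉ Icc a b, ψ x = 0 := fun x hx =>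
    image_eq_zero_of_notMem_tsupport fun h => hx (hab h)
  have hsub : Function.support φ ⊆ Icc a b := by
    intro x hx
    by_contra hxn
    apply hx
    rw [mem_Icc, not_and_or, not_le, not_le] at hxn
    rcases hxn with hxa | hxb
    · rw [hφ]
      refine (intervalIntegral.integral_congr (g := fun _ => 0) fun t ht => ?_).trans (by simp)
      refine hz' t fun h => ?_
      have := h.1
      rcases le_max_iff.1 ht.2 with h | h <;> linarith
    · have e : φ x = φ 1 + ∫ t in (1 : ℝ)..x, ψ t :=
        (intervalIntegral.integral_add_adjacent_intervals
          (hψ.continuous.intervalIntegrable _ _) (hψ.continuous.intervalIntegrable _ _)).symm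
      rw [e, hφ]
      simp only [h0, zero_add]
      refine (intervalIntegral.integral_congr (g := fun _ => 0) fun t ht => ?_).trans (by simp)
      refine hz' t fun h => ?_
      have := h.2
      rcases min_le_iff.1 ht.1 with h | h <;> linarith
  have hts : tsupport φ ⊆ Icc a b := closure_minimal hsub isClosed_Icc
  refine ⟨φ, ?_, ?_, hts.trans fun x hx => ⟨ha.trans_le hx.1, hx.2.trans_lt hb⟩, hder⟩
  · rw [contDiff_infty_iff_deriv]
    exact ⟨fun x => (hd x).differentiableAt, by rwa [hder]⟩
  · exact isCompact_Icc.of_isClosed_subset (isClosed_tsupport φ) hts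

/-- The du Bois-Reymond lemma: a continuous function with zero weak derivative is constant. -/
theorem IsWeakDeriv.eq_of_zero {f : ℝ → ℝ} (hf : ContinuousOn f (Icc 0 1))
    (h : IsWeakDeriv f 0) : ∀ x ∈ Icc (0 : ℝ) 1, f x = f 0 := by
  let B : ContDiffBump (1 / 2 : ℝ) := ⟨1 / 8, 1 / 4, by norm_num, by norm_num⟩
  set η : ℝ → ℝ := B.normed volume with hη
  have hηc : ContDiff ℝ ∞ η := B.contDiff_normed
  have hηs : tsupport η ⊆ Ioo 0 1 := by
    rw [hη, B.tsupport_normed_eq, Real.closedBall_eq_Icc]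
    exact fun x hx => ⟨by have := hx.1; norm_num [B] at this; linarith,
      by have := hx.2; norm_num [B] at this; linarith⟩
  have hηk : HasCompactSupport η := B.hasCompactSupport_normed
  have e : ∀ k : ℝ → ℝ, tsupport k ⊆ Ioo 0 1 → ∀ u : ℝ → ℝ,
      ∫ x in Ioo (0 : ℝ) 1, u x * k x = ∫ x, u x * k x := fun k hk u => by
    rw [setIntegral_eq_integral_of_forall_compl_eq_zero]
    intro x hx
    rw [image_eq_zero_of_notMem_tsupport fun h => hx (hk h), mul_zero]
  have hη1 : ∫ x in Ioo (0 : ℝ) 1, η x = 1 := by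
    have := e η hηs (fun _ => 1)
    simp only [one_mul] at this
    rw [this]
    exact B.integral_normed
  have hfi : IntegrableOn f (Ioo 0 1) := hf.integrableOn_Icc.mono_set Ioo_subset_Icc_self
  have hb : ∀ k : ℝ → ℝ, Continuous k → HasCompactSupport k → ∀ u : ℝ → ℝ,
      IntegrableOn u (Ioo 0 1) → IntegrableOn (fun x => u x * k x) (Ioo 0 1) := by
    intro k hk hc u hu
    obtain ⟨C, hC⟩ := hk.bounded_above_of_compact_support hc
    exact hu.mul_bdd hk.aestronglyMeasurable (ae_of_all _ hC)
  set c := ∫ x in Ioo (0 : ℝ) 1, f x * η x with hc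
  have hone : IntegrableOn (fun _ : ℝ => (1 : ℝ)) (Ioo 0 1) := by simp
  have hae := isOpen_Ioo.ae_eq_zero_of_integral_contDiff_smul_eq_zero
    (μ := volume) (U := Ioo (0 : ℝ) 1) (f := fun x => f x - c)
    (hfi.sub (by simp)).locallyIntegrableOn fun ψ hψ hψc hψs => by
      set m := ∫ x in Ioo (0 : ℝ) 1, ψ x with hm
      have hψi : IntegrableOn ψ (Ioo 0 1) := by simpa using hb ψ hψ.continuous hψc _ hone
      have hηi : IntegrableOn η (Ioo 0 1) := by simpa using hb η hηc.continuous hηk _ hone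
      obtain ⟨φ, h1, h2, h3, h4⟩ := exists_contDiff_deriv_eq (ψ := fun x => ψ x - m * η x)
        (hψ.sub (contDiff_const.mul hηc))
        ((tsupport_sub ψ fun x => m * η x).trans
          (union_subset hψs ((tsupport_mul_subset_right).trans hηs))) (by
            rw [← setIntegral_Ioo_eq_intervalIntegral zero_le_one,
              integral_sub hψi (hηi.const_mul m), integral_const_mul, hη1]
            simp [hm])
      have h5 := h.2 φ h1 h2 h3
      rw [h4] at h5
      simp only [Pi.zero_apply, zero_mul, integral_zero, neg_zero, mul_sub] at h5
      have e1 : ∀ x, f x * (m * η x) = m * (f x * η x) := fun x => by ring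
      simp only [e1] at h5
      rw [integral_sub (hb ψ hψ.continuous hψc f hfi)
        ((hb η hηc.continuous hηk f hfi).const_mul m), integral_const_mul, ← hc] at h5
      have e2 := e ψ hψs (fun x => f x - c)
      simp only [smul_eq_mul, mul_comm (ψ _)]
      rw [← e2]
      simp only [sub_mul]
      rw [integral_sub (hb ψ hψ.continuous hψc f hfi) (hψi.const_mul c), integral_const_mul,
        ← hm]
      linarith
  -- a continuous function that is constant almost everywhere is constant
  have hall : ∀ x ∈ Icc (0 : ℝ) 1, f x = c := by
    have : EqOn f (fun _ => c) (Icc 0 1) := by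
      refine MeasureTheory.Measure.eqOn_of_ae_eq (μ := volume) ?_ hf continuousOn_const ?_
      · rw [EventuallyEq, ae_restrict_iff' measurableSet_Icc]
        have h0 : ∀ᵐ x : ℝ, x ≠ 0 := by simp [ae_iff]
        have h1 : ∀ᵐ x : ℝ, x ≠ 1 := by simp [ae_iff]
        filter_upwards [hae, h0, h1] with x hx hx0 hx1 hxm
        exact sub_eq_zero.1 (hx ⟨lt_of_le_of_ne hxm.1 hx0.symm, lt_of_le_of_ne hxm.2 hx1⟩)
      · rw [interior_Icc, closure_Ioo zero_ne_one]
    exact this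
  intro x hx
  rw [hall x hx, hall 0 (by simp)]

/-- A continuous function is a primitive of its weak derivative. -/
theorem IsWeakDeriv.eq_integral {r g : ℝ → ℝ} (hr : ContinuousOn r (Icc 0 1))
    (h : IsWeakDeriv r g) : ∀ x ∈ Icc (0 : ℝ) 1, r x = r 0 + ∫ t in (0 : ℝ)..x, g t := by
  have hgi := intervalIntegrable_of_integrableOn_Ioo zero_le_one h.1
  have hG :=
    (hgi.absolutelyContinuousOnInterval_intervalIntegral (c := 0) left_mem_uIcc).continuousOn
  rw [uIcc_of_le zero_le_one] at hG
  have hw : IsWeakDeriv (fun x => ∫ t in (0 : ℝ)..x, g t) g :=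
    .of_eq_integral h.1 0 fun x _ => by simp
  have hz : IsWeakDeriv (fun x => r x - ∫ t in (0 : ℝ)..x, g t) 0 := by
    refine ⟨integrableOn_zero, fun φ hφ hc hs => ?_⟩
    have hb : ∀ u : ℝ → ℝ, ContinuousOn u (Icc 0 1) →
        IntegrableOn (fun x => u x * deriv φ x) (Ioo 0 1) := fun u hu =>
      ((hu.mul (hφ.continuous_deriv (by simp)).continuousOn).integrableOn_Icc).mono_set
        Ioo_subset_Icc_self
    simp only [sub_mul]
    rw [integral_sub (hb _ hr) (hb _ hG), h.2 φ hφ hc hs, hw.2 φ hφ hc hs]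
    simp
  intro x hx
  have := hz.eq_of_zero (hr.sub hG) x hx
  simp only [Pi.sub_apply, intervalIntegral.integral_same] at this
  linarith

theorem isWeakDeriv_weakDeriv {r : ℝ → ℝ} (h : ∃ g, IsWeakDeriv r g) :
    IsWeakDeriv r (weakDeriv r) := by
  rw [weakDeriv, dif_pos h]
  exact h.choose_spec

/-! ### Admissible profiles and the finiteness of the energy -/

/-- `r` is an admissible profile and `g` a version of its weak derivative: `r` is a primitive of the
integrable, almost everywhere positive function `g`. -/
structure IsProfile (lam : ℝ) (r g : ℝ → ℝ) : Prop where
  integrableOn : IntegrableOn g (Ioo 0 1)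
  eq_integral : ∀ x ∈ Icc (0 : ℝ) 1, r x = r 0 + ∫ t in (0 : ℝ)..x, g t
  ae_pos : ∀ᵐ R ∂volume.restrict (Ioo (0 : ℝ) 1), 0 < g R
  map_one : r 1 = lam
  map_zero_nonneg : 0 ≤ r 0

variable {n : ℕ} {κ lam : ℝ} {h r g : ℝ → ℝ}

theorem isProfile_of_mem_admissible (hr : r ∈ Admissible lam) :
    IsProfile lam r (weakDeriv r) := by
  obtain ⟨⟨hc, hw⟩, h1, hpos, h0⟩ := hr
  have := isWeakDeriv_weakDeriv hw
  exact ⟨this.1, this.eq_integral hc, hpos, h1, h0⟩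

namespace IsProfile

theorem intervalIntegrable (hp : IsProfile lam r g) : IntervalIntegrable g volume 0 1 :=
  intervalIntegrable_of_integrableOn_Ioo zero_le_one hp.integrableOn

theorem intervalIntegrable_of_mem (hp : IsProfile lam r g) {x y : ℝ} (hx : x ∈ Icc (0 : ℝ) 1)
    (hy : y ∈ Icc (0 : ℝ) 1) : IntervalIntegrable g volume x y :=
  hp.intervalIntegrable.mono_set (by
    rw [uIcc_of_le zero_le_one]; exact uIcc_subset_Icc hx hy)

theorem continuousOn (hp : IsProfile lam r g) : ContinuousOn r (Icc 0 1) := by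
  have hG := (hp.intervalIntegrable.absolutelyContinuousOnInterval_intervalIntegral
    (c := 0) left_mem_uIcc).continuousOn
  rw [uIcc_of_le zero_le_one] at hG
  exact (continuousOn_const.add hG).congr hp.eq_integral

theorem sub_eq_integral (hp : IsProfile lam r g) {x y : ℝ} (hx : x ∈ Icc (0 : ℝ) 1)
    (hy : y ∈ Icc (0 : ℝ) 1) : r y - r x = ∫ t in x..y, g t := by
  have h0 : (0 : ℝ) ∈ Icc (0 : ℝ) 1 := by simp
  rw [hp.eq_integral x hx, hp.eq_integral y hy,
    ← intervalIntegral.integral_add_adjacent_intervals (hp.intervalIntegrable_of_mem h0 hx)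
      (hp.intervalIntegrable_of_mem hx hy)]
  ring

theorem strictMonoOn (hp : IsProfile lam r g) : StrictMonoOn r (Icc 0 1) := by
  intro x hx y hy hxy
  rw [← sub_pos, hp.sub_eq_integral hx hy]
  have hae : ∀ᵐ t, t ∈ Ioo (0 : ℝ) 1 → 0 < g t := (ae_restrict_iff' measurableSet_Ioo).1 hp.ae_pos
  have h1 : ∀ᵐ t : ℝ, t ≠ 1 := by simp [ae_iff]
  have hae' : ∀ᵐ t, t ∈ Ioc x y → 0 < g t := by
    filter_upwards [hae, h1] with t ht ht1 hxt
    exact ht ⟨hx.1.trans_lt hxt.1, lt_of_le_of_ne (hxt.2.trans hy.2) ht1⟩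
  rw [intervalIntegral.integral_pos_iff_support_of_nonneg_ae' _ (hp.intervalIntegrable_of_mem hx hy)]
  · refine ⟨hxy, lt_of_lt_of_le (b := volume (Ioc x y)) (by simpa using hxy) (measure_mono_ae ?_)⟩
    filter_upwards [hae'] with t ht hxt
    exact ⟨(ht hxt).ne', hxt⟩
  · rw [uIoc_of_le hxy.le]
    exact (ae_restrict_iff' measurableSet_Ioc).2 (hae'.mono fun t ht hxt => (ht hxt).le)

theorem pos (hp : IsProfile lam r g) {x : ℝ} (hx : x ∈ Ioc (0 : ℝ) 1) : 0 < r x :=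
  hp.map_zero_nonneg.trans_lt
    (hp.strictMonoOn (left_mem_Icc.2 zero_le_one) (Ioc_subset_Icc_self hx) hx.1)

theorem le_lam (hp : IsProfile lam r g) {x : ℝ} (hx : x ∈ Icc (0 : ℝ) 1) : r x ≤ lam :=
  hp.map_one ▸ hp.strictMonoOn.monotoneOn hx (right_mem_Icc.2 zero_le_one) hx.2

theorem isWeakDeriv (hp : IsProfile lam r g) : IsWeakDeriv r g :=
  .of_eq_integral hp.integrableOn _ hp.eq_integral

theorem weakDeriv_ae_eq (hp : IsProfile lam r g) :
    weakDeriv r =ᵐ[volume.restrict (Ioo 0 1)] g :=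
  (isWeakDeriv_weakDeriv ⟨g, hp.isWeakDeriv⟩).ae_eq hp.isWeakDeriv

theorem mem_admissible (hp : IsProfile lam r g) : r ∈ Admissible lam := by
  refine ⟨⟨hp.continuousOn, g, hp.isWeakDeriv⟩, hp.map_one, ?_, hp.map_zero_nonneg⟩
  filter_upwards [hp.ae_pos, hp.weakDeriv_ae_eq] with x hx hxe
  rwa [hxe]

end IsProfile

theorem aemeasurable_comp_of_continuousOn_Ioi {α : Type*} [MeasurableSpace α] {μ : Measure α}
    {u : α → ℝ} {f : ℝ → ℝ} (hf : ContinuousOn f (Ioi 0)) (hu : AEMeasurable u μ)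
    (hpos : ∀ᵐ x ∂μ, 0 < u x) : AEMeasurable (fun x => f (u x)) μ := by
  have hm : Measurable ((Ioi (0 : ℝ)).indicator f) := by
    classical
    rw [← piecewise_eq_indicator]
    exact hf.measurable_piecewise continuousOn_const measurableSet_Ioi
  refine (hm.comp_aemeasurable hu).congr ?_
  filter_upwards [hpos] with x hx
  simp [indicator_of_mem (mem_Ioi.2 hx)]

theorem IsProfile.aemeasurable_deriv (hp : IsProfile lam r g) :
    AEMeasurable g (volume.restrict (Ioo 0 1)) :=
  hp.integrableOn.aestronglyMeasurable.aemeasurable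

theorem IsProfile.aemeasurable (hp : IsProfile lam r g) :
    AEMeasurable r (volume.restrict (Ioo 0 1)) :=
  (hp.continuousOn.mono Ioo_subset_Icc_self).aemeasurable measurableSet_Ioo

theorem IsProfile.ae_stretch_pos (hp : IsProfile lam r g) :
    ∀ᵐ R ∂volume.restrict (Ioo (0 : ℝ) 1), 0 < g R * (r R / R) ^ (n - 1) := by
  filter_upwards [hp.ae_pos, ae_restrict_mem measurableSet_Ioo] with R hR hRm
  have := hp.pos ⟨hRm.1, hRm.2.le⟩
  have := hRm.1
  positivity

theorem IsProfile.aemeasurable_comp_stretch (hp : IsProfile lam r g) {f : ℝ → ℝ}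
    (hf : ContinuousOn f (Ioi 0)) :
    AEMeasurable (fun R => f (g R * (r R / R) ^ (n - 1))) (volume.restrict (Ioo 0 1)) :=
  aemeasurable_comp_of_continuousOn_Ioi hf
    (hp.aemeasurable_deriv.mul ((hp.aemeasurable.div aemeasurable_id).pow_const _))
    hp.ae_stretch_pos

theorem IsProfile.aemeasurable_modifiedDensity (hh : IsVolumetricEnergy h)
    (hp : IsProfile lam r g) :
    AEMeasurable (fun R => modifiedDensity n κ h R (r R) (g R)) (volume.restrict (Ioo 0 1)) := by
  have h1 := hp.aemeasurable_comp_stretch (n := n) hh.contDiffOn.continuousOn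
  have h2 := hp.aemeasurable_deriv
  have h3 := hp.aemeasurable.div (aemeasurable_id (μ := volume.restrict (Ioo (0 : ℝ) 1)))
  have h4 : AEMeasurable (fun R : ℝ => Real.log (r R / R)) (volume.restrict (Ioo 0 1)) := h3.log
  unfold modifiedDensity
  exact (aemeasurable_id.pow_const _).mul ((((h2.pow_const n).const_mul _).add h1).add
    (((h2.mul (h3.pow_const _)).const_mul _).mul (h4.const_add _)))

/-- The logarithmic term is the only one that can be negative, and it is at least `-C r'`. -/
theorem neg_modifiedDensity_le (hn : 2 ≤ n) (hκ : 0 < κ) (hh : IsVolumetricEnergy h) {R s q : ℝ}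
    (hR : R ∈ Ioo (0 : ℝ) 1) (hs : 0 < s) (hsl : s ≤ lam) (hq : 0 < q) :
    -modifiedDensity n κ h R s q ≤ κ * ((n : ℝ) - 1) * lam ^ (n - 2) * q := by
  obtain ⟨hR0, hR1⟩ := hR
  have hn1 : (0 : ℝ) < (n : ℝ) - 1 := by
    have : (2 : ℝ) ≤ n := by exact_mod_cast hn
    linarith
  have hδ : 0 < q * (s / R) ^ (n - 1) := by positivity
  have hlog : -(1 / s) ≤ 1 / n + Real.log (s / R) := by
    rw [Real.log_div hs.ne' hR0.ne']
    have h1 := Real.one_sub_inv_le_log_of_pos hs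
    have h2 := Real.log_neg hR0 hR1
    have h3 : (0 : ℝ) ≤ 1 / n := by positivity
    rw [one_div s]
    linarith
  have e : modifiedDensity n κ h R s q = R ^ (n - 1) * (κ / n * q ^ n)
      + R ^ (n - 1) * h (q * (s / R) ^ (n - 1))
      + κ * ((n : ℝ) - 1) * q * s ^ (n - 1) * (1 / n + Real.log (s / R)) := by
    unfold modifiedDensity
    rw [div_pow]
    field_simp
  have t1 : 0 ≤ R ^ (n - 1) * (κ / n * q ^ n) := by positivity
  have t2 : 0 ≤ R ^ (n - 1) * h (q * (s / R) ^ (n - 1)) :=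
    mul_nonneg (by positivity) (hh.nonneg _ hδ)
  have t3 : κ * ((n : ℝ) - 1) * q * s ^ (n - 1) * (-(1 / s)) ≤
      κ * ((n : ℝ) - 1) * q * s ^ (n - 1) * (1 / n + Real.log (s / R)) :=
    mul_le_mul_of_nonneg_left hlog (by positivity)
  have t4 : κ * ((n : ℝ) - 1) * q * s ^ (n - 1) * (-(1 / s)) =
      -(κ * ((n : ℝ) - 1) * s ^ (n - 2) * q) := by
    rw [show n - 1 = n - 2 + 1 by omega, pow_succ]
    field_simp
  have t5 : κ * ((n : ℝ) - 1) * s ^ (n - 2) * q ≤ κ * ((n : ℝ) - 1) * lam ^ (n - 2) * q := by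
    gcongr
  rw [e]
  linarith

theorem IsProfile.lintegral_neg_modifiedDensity_ne_top (hn : 2 ≤ n) (hκ : 0 < κ)
    (hh : IsVolumetricEnergy h) (hp : IsProfile lam r g) :
    ∫⁻ R in Ioo (0 : ℝ) 1, ENNReal.ofReal (-modifiedDensity n κ h R (r R) (g R)) ≠ ⊤ := by
  refine ne_top_of_le_ne_top (b := ∫⁻ R in Ioo (0 : ℝ) 1,
    ENNReal.ofReal (κ * ((n : ℝ) - 1) * lam ^ (n - 2) * g R)) ?_ (lintegral_mono_ae ?_)
  · exact (hp.integrableOn.const_mul _).lintegral_lt_top.ne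
  · filter_upwards [hp.ae_pos, ae_restrict_mem measurableSet_Ioo] with R hg hR
    exact ENNReal.ofReal_le_ofReal (neg_modifiedDensity_le hn hκ hh hR
      (hp.pos ⟨hR.1, hR.2.le⟩) (hp.le_lam (Ioo_subset_Icc_self hR)) hg)

theorem IsProfile.modifiedEnergy_eq_lintegral (hp : IsProfile lam r g) :
    modifiedEnergy n κ h lam r =
      ((∫⁻ R in Ioo (0 : ℝ) 1, ENNReal.ofReal (modifiedDensity n κ h R (r R) (g R)) : ℝ≥0∞)
        : EReal)
      - ((∫⁻ R in Ioo (0 : ℝ) 1, ENNReal.ofReal (- modifiedDensity n κ h R (r R) (g R))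
        : ℝ≥0∞) : EReal)
      - ((κ * ((n : ℝ) - 1) / n * lam ^ n * Real.log lam : ℝ) : EReal) := by
  unfold modifiedEnergy
  rw [lintegral_congr_ae (f := fun R => ENNReal.ofReal (modifiedDensity n κ h R (r R)
      (weakDeriv r R))) (g := fun R => ENNReal.ofReal (modifiedDensity n κ h R (r R) (g R))),
    lintegral_congr_ae (f := fun R => ENNReal.ofReal (-modifiedDensity n κ h R (r R)
      (weakDeriv r R))) (g := fun R => ENNReal.ofReal (-modifiedDensity n κ h R (r R) (g R)))]
  all_goals
    filter_upwards [hp.weakDeriv_ae_eq] with R hR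
    rw [hR]

/-- For an integrable density the extended real valued energy is the Bochner integral, up to the
boundary constant. -/
theorem IsProfile.modifiedEnergy_eq_integral (hp : IsProfile lam r g)
    (hi : IntegrableOn (fun R => modifiedDensity n κ h R (r R) (g R)) (Ioo 0 1)) :
    modifiedEnergy n κ h lam r = (((∫ R in Ioo (0 : ℝ) 1, modifiedDensity n κ h R (r R) (g R))
      - κ * ((n : ℝ) - 1) / n * lam ^ n * Real.log lam : ℝ) : EReal) := by
  rw [hp.modifiedEnergy_eq_lintegral, integral_eq_lintegral_pos_part_sub_lintegral_neg_part hi]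
  have h1 : ∫⁻ R in Ioo (0 : ℝ) 1, ENNReal.ofReal (modifiedDensity n κ h R (r R) (g R)) ≠ ⊤ :=
    hi.lintegral_lt_top.ne
  have h2 : ∫⁻ R in Ioo (0 : ℝ) 1, ENNReal.ofReal (-modifiedDensity n κ h R (r R) (g R)) ≠ ⊤ :=
    hi.neg.lintegral_lt_top.ne
  rw [EReal.coe_sub, EReal.coe_sub, EReal.coe_ennreal_toReal h1, EReal.coe_ennreal_toReal h2]

theorem IsProfile.integrableOn_modifiedDensity (hn : 2 ≤ n) (hκ : 0 < κ)
    (hh : IsVolumetricEnergy h) (hp : IsProfile lam r g)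
    (hlt : modifiedEnergy n κ h lam r < ⊤) :
    IntegrableOn (fun R => modifiedDensity n κ h R (r R) (g R)) (Ioo 0 1) := by
  have h2 := hp.lintegral_neg_modifiedDensity_ne_top hn hκ hh
  rw [hp.modifiedEnergy_eq_lintegral] at hlt
  have h1 : ∫⁻ R in Ioo (0 : ℝ) 1, ENNReal.ofReal (modifiedDensity n κ h R (r R) (g R)) ≠ ⊤ := by
    -- with a finite negative part, an infinite positive part makes the energy infinite
    intro htop
    rw [htop] at hlt
    lift (∫⁻ R in Ioo (0 : ℝ) 1, ENNReal.ofReal (-modifiedDensity n κ h R (r R) (g R)))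
      to NNReal using h2 with b
    have : ((⊤ : ℝ≥0∞) : EReal) - ((b : ℝ≥0∞) : EReal) = ⊤ := EReal.top_sub_coe (b : ℝ)
    rw [this] at hlt
    exact hlt.ne (EReal.top_sub_coe _)
  refine ⟨(hp.aemeasurable_modifiedDensity hh).aestronglyMeasurable, ?_⟩
  rw [hasFiniteIntegral_iff_norm]
  refine lt_of_le_of_lt (lintegral_mono fun R => ?_)
    (lt_of_le_of_lt (lintegral_add_left' ?_ _).le (ENNReal.add_lt_top.2 ⟨h1.lt_top, h2.lt_top⟩))
  · rw [Real.norm_eq_abs]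
    rcases abs_cases (modifiedDensity n κ h R (r R) (g R)) with ⟨e, _⟩ | ⟨e, _⟩
    · rw [e]; exact le_self_add
    · rw [e]; exact le_add_self
  · exact (hp.aemeasurable_modifiedDensity hh).ennreal_ofReal

/-- The homogeneous deformation `R ↦ λ R`. -/
theorem isProfile_homogeneous (hlam : 0 < lam) : IsProfile lam (fun R => lam * R) fun _ => lam := by
  refine ⟨by simp, fun x _ => by simp [mul_comm], ?_, by simp, by simp⟩
  exact ae_of_all _ fun _ => hlam

theorem modifiedEnergy_homogeneous_lt_top (hlam : 0 < lam) :
    modifiedEnergy n κ h lam (fun R => lam * R) < ⊤ := by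
  rw [(isProfile_homogeneous hlam).modifiedEnergy_eq_integral]
  · exact EReal.coe_lt_top _
  · have hc : Continuous fun R : ℝ => R ^ (n - 1) * (κ / n * lam ^ n + h (lam * lam ^ (n - 1))
        + κ * ((n : ℝ) - 1) * (lam * lam ^ (n - 1)) * (1 / n + Real.log lam)) := by fun_prop
    refine ((hc.integrableOn_Icc (a := 0) (b := 1)).mono_set Ioo_subset_Icc_self).congr_fun ?_
      measurableSet_Ioo
    intro R hR
    have : lam * R / R = lam := mul_div_cancel_right₀ _ hR.1.ne'
    simp only [modifiedDensity, this]

/-- A minimizer has integrable energy density and minimizes the energy as a Bochner integral. -/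
theorem integrableOn_and_integral_le_of_isMinOn (hn : 2 ≤ n) (hκ : 0 < κ) (hlam : 0 < lam)
    (hh : IsVolumetricEnergy h) (hp : IsProfile lam r g)
    (hmin : IsMinOn (modifiedEnergy n κ h lam) (Admissible lam) r) :
    IntegrableOn (fun R => modifiedDensity n κ h R (r R) (g R)) (Ioo 0 1) ∧
      ∀ ρ γ : ℝ → ℝ, IsProfile lam ρ γ →
        IntegrableOn (fun R => modifiedDensity n κ h R (ρ R) (γ R)) (Ioo 0 1) →
        ∫ R in Ioo (0 : ℝ) 1, modifiedDensity n κ h R (r R) (g R) ≤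
          ∫ R in Ioo (0 : ℝ) 1, modifiedDensity n κ h R (ρ R) (γ R) := by
  have hi := hp.integrableOn_modifiedDensity hn hκ hh
    ((hmin (isProfile_homogeneous hlam).mem_admissible).trans_lt
      (modifiedEnergy_homogeneous_lt_top hlam))
  refine ⟨hi, fun ρ γ hρ hρi => ?_⟩
  have := hmin hρ.mem_admissible
  simp only [mem_ofPred_eq] at this
  rw [hp.modifiedEnergy_eq_integral hi, hρ.modifiedEnergy_eq_integral hρi,
    EReal.coe_le_coe_iff] at this
  linarith

/-! ### Variation of the density along relative perturbations -/

/-- The derivative of the modified density at `(s, q)` in the direction `(s β, q τ)`; the relative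
rates `β`, `τ` of the two arguments enter linearly. -/
noncomputable def densityVariation (n : ℕ) (κ : ℝ) (h : ℝ → ℝ) (R s q τ β : ℝ) : ℝ :=
  R ^ (n - 1) * (κ * q ^ n * τ
    + (τ + ((n : ℝ) - 1) * β) * (q * (s / R) ^ (n - 1) * deriv h (q * (s / R) ^ (n - 1)))
    + κ * ((n : ℝ) - 1) * (q * (s / R) ^ (n - 1)) *
      ((τ + ((n : ℝ) - 1) * β) * (1 / n + Real.log (s / R)) + β))

theorem IsVolumetricEnergy.hasDerivAt (hh : IsVolumetricEnergy h) {d : ℝ} (hd : 0 < d) :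
    HasDerivAt h (deriv h d) d :=
  ((hh.contDiffOn.differentiableOn (by simp)).differentiableAt (Ioi_mem_nhds hd)).hasDerivAt

theorem IsVolumetricEnergy.continuousOn_deriv (hh : IsVolumetricEnergy h) :
    ContinuousOn (deriv h) (Ioi 0) := fun d hd =>
  (hh.differentiableAt_deriv d hd).continuousAt.continuousWithinAt

theorem hasDerivAt_stretch (hn : 2 ≤ n) {R ε τ β : ℝ} {S Q : ℝ → ℝ}
    (hS : HasDerivAt S (S ε * β) ε) (hQ : HasDerivAt Q (Q ε * τ) ε) :
    HasDerivAt (fun e => Q e * (S e / R) ^ (n - 1))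
      (Q ε * (S ε / R) ^ (n - 1) * (τ + ((n : ℝ) - 1) * β)) ε := by
  obtain ⟨m, rfl⟩ := Nat.exists_eq_add_of_le hn
  have := hQ.mul ((hS.div_const R).pow (2 + m - 1))
  convert! this using 1
  simp only [show 2 + m - 1 = m + 1 by omega, Pi.pow_apply]
  push_cast
  ring

/-- Along a curve `(S, Q)` the derivative of the density depends on the velocity only through the
logarithmic derivatives `β` of `S` and `τ` of `Q`. -/
theorem hasDerivAt_modifiedDensity (hn : 2 ≤ n) (hh : IsVolumetricEnergy h) {R ε τ β : ℝ}
    {S Q : ℝ → ℝ} (hR : 0 < R) (hS0 : 0 < S ε) (hQ0 : 0 < Q ε)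
    (hS : HasDerivAt S (S ε * β) ε) (hQ : HasDerivAt Q (Q ε * τ) ε) :
    HasDerivAt (fun e => modifiedDensity n κ h R (S e) (Q e))
      (densityVariation n κ h R (S ε) (Q ε) τ β) ε := by
  have hδ : 0 < Q ε * (S ε / R) ^ (n - 1) := by positivity
  have hn0 : (n : ℝ) ≠ 0 := by positivity
  have h1 := hasDerivAt_stretch (R := R) hn hS hQ
  have h2 := (hh.hasDerivAt hδ).comp ε h1
  have h3 := ((hS.div_const R).log (by positivity)).const_add (1 / (n : ℝ))
  have h4 := (hQ.pow n).const_mul (κ / n)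
  have h5 := (((h4.add h2).add ((h1.const_mul (κ * ((n : ℝ) - 1))).mul h3)).const_mul (R ^ (n - 1)))
  convert! h5 using 1
  unfold densityVariation
  have e1 : Q ε ^ n = Q ε ^ (n - 1) * Q ε := by
    rw [← pow_succ, Nat.sub_add_cancel (by omega)]
  have e2 : S ε * β / R / (S ε / R) = β := by field_simp
  rw [e2, e1]
  field_simp

/-- The growth condition bounds the variation at a nearby state by the density at the given state:
the factor `c` relating the two values of the determinant is close to `1`. -/
theorem exists_abs_densityVariation_le (hn : 2 ≤ n) (hκ : 0 < κ) (hh : IsVolumetricEnergy h)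
    (hgrowth : DerivGrowth h) {Λ M : ℝ} (hM : 0 ≤ M) :
    ∃ C ≥ 0, ∃ η > 0, η ≤ 1 / 2 ∧ ∀ R s q x y τ β : ℝ, 0 < R → 0 < s → 0 < q →
      |x| ≤ η → |y| ≤ η → |Real.log (s * (1 + x) / R)| ≤ Λ → |τ| ≤ M → |β| ≤ M →
      |densityVariation n κ h R (s * (1 + x)) (q * (1 + y)) τ β| ≤
        C * (R ^ (n - 1) * (q ^ n + (h (q * (s / R) ^ (n - 1)) + 1) + q * (s / R) ^ (n - 1))) := by
  obtain ⟨K, hK, γ₀, hγ, hG⟩ := hgrowth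
  have hcont : ContinuousAt (fun p : ℝ × ℝ => (1 + p.2) * (1 + p.1) ^ (n - 1)) (0, 0) := by
    fun_prop
  obtain ⟨η₀, hη₀, hη⟩ := Metric.continuousAt_iff.1 hcont γ₀ hγ
  have hn1 : (0 : ℝ) < (n : ℝ) - 1 := by
    have : (2 : ℝ) ≤ n := by exact_mod_cast hn
    linarith
  set C := 2 ^ n * (κ * M + n * M * K + κ * ((n : ℝ) - 1) * (n * M * (1 + |Λ|) + M)) with hC
  refine ⟨C, by positivity, min (η₀ / 2) (1 / 2), by positivity, min_le_right _ _, ?_⟩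
  intro R s q x y τ β hR hs hq hx hy hlog hτ hβ
  have hx1 := hx.trans (min_le_left _ _)
  have hx2 := hx.trans (min_le_right _ _)
  have hy1 := hy.trans (min_le_left _ _)
  have hy2 := hy.trans (min_le_right _ _)
  have hx3 : 0 < 1 + x := by linarith [(abs_le.1 hx2).1]
  have hx4 : 1 + x ≤ 2 := by linarith [(abs_le.1 hx2).2]
  have hy3 : 0 < 1 + y := by linarith [(abs_le.1 hy2).1]
  have hy4 : 1 + y ≤ 2 := by linarith [(abs_le.1 hy2).2]
  set c := (1 + y) * (1 + x) ^ (n - 1) with hc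
  set δ := q * (s / R) ^ (n - 1) with hδ
  have hc0 : 0 < c := by positivity
  have hδ0 : 0 < δ := by positivity
  have hcγ : |c - 1| ≤ γ₀ := by
    have := hη (x := (x, y)) (by
      rw [Prod.dist_eq, max_lt_iff]
      simp only [Real.dist_eq, sub_zero]
      constructor <;> linarith)
    simp only [Real.dist_eq, add_zero, one_pow, mul_one] at this
    exact this.le
  have hc2 : c ≤ 2 ^ n := by
    calc c ≤ 2 * 2 ^ (n - 1) := by rw [hc]; gcongr
      _ = 2 ^ n := by rw [← pow_succ', Nat.sub_add_cancel (by omega)]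
  have hδ' : q * (1 + y) * (s * (1 + x) / R) ^ (n - 1) = c * δ := by
    rw [hc, hδ, show s * (1 + x) / R = (1 + x) * (s / R) by ring, mul_pow]
    ring
  have hh0 := hh.nonneg δ hδ0
  have hσ : |τ + ((n : ℝ) - 1) * β| ≤ n * M := by
    calc |τ + ((n : ℝ) - 1) * β| ≤ |τ| + ((n : ℝ) - 1) * |β| := by
          refine (abs_add_le _ _).trans ?_
          rw [abs_mul, abs_of_pos hn1]
      _ ≤ M + ((n : ℝ) - 1) * M := by gcongr
      _ = n * M := by ring
  have b1 : |κ * (q * (1 + y)) ^ n * τ| ≤ 2 ^ n * (κ * M) * q ^ n := by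
    rw [abs_mul, abs_of_pos (by positivity), mul_pow]
    calc κ * (q ^ n * (1 + y) ^ n) * |τ| ≤ κ * (q ^ n * 2 ^ n) * M := by gcongr
      _ = _ := by ring
  have b2 : |(τ + ((n : ℝ) - 1) * β) * (c * δ * deriv h (c * δ))| ≤
      2 ^ n * (n * M * K) * (h δ + 1) := by
    rw [abs_mul, mul_assoc c, abs_mul c, abs_of_pos hc0]
    calc _ ≤ n * M * (2 ^ n * (K * (h δ + 1))) := by
          gcongr
          exact hG δ hδ0 c hc0 hcγ
      _ = _ := by ring
  have b3 : |κ * ((n : ℝ) - 1) * (c * δ) *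
      ((τ + ((n : ℝ) - 1) * β) * (1 / n + Real.log (s * (1 + x) / R)) + β)| ≤
      2 ^ n * (κ * ((n : ℝ) - 1) * (n * M * (1 + |Λ|) + M)) * δ := by
    rw [abs_mul, abs_of_pos (by positivity)]
    have h1n : |1 / n + Real.log (s * (1 + x) / R)| ≤ 1 + |Λ| := by
      refine (abs_add_le _ _).trans (add_le_add ?_ (hlog.trans (le_abs_self _)))
      rw [abs_of_nonneg (by positivity)]
      exact div_le_one_of_le₀ (by linarith) (by positivity)
    have : |(τ + ((n : ℝ) - 1) * β) * (1 / n + Real.log (s * (1 + x) / R)) + β| ≤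
        n * M * (1 + |Λ|) + M := by
      refine (abs_add_le _ _).trans (add_le_add ?_ hβ)
      rw [abs_mul]
      gcongr
    calc _ ≤ κ * ((n : ℝ) - 1) * (2 ^ n * δ) * (n * M * (1 + |Λ|) + M) := by gcongr
      _ = _ := by ring
  unfold densityVariation
  have hRn : (0 : ℝ) < R ^ (n - 1) := pow_pos hR _
  rw [hδ', abs_mul, abs_of_pos hRn, mul_left_comm C]
  refine mul_le_mul_of_nonneg_left ?_ hRn.le
  refine (abs_add_three _ _ _).trans ((add_le_add (add_le_add b1 b2) b3).trans ?_)
  have e1 : 2 ^ n * (κ * M) ≤ C := by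
    rw [hC]; gcongr; rw [add_assoc]; exact le_add_of_nonneg_right (by positivity)
  have e2 : 2 ^ n * (n * M * K) ≤ C := by
    rw [hC]; gcongr
    have : 0 ≤ κ * M := by positivity
    have : 0 ≤ κ * ((n : ℝ) - 1) * (n * M * (1 + |Λ|) + M) := by positivity
    linarith
  have e3 : 2 ^ n * (κ * ((n : ℝ) - 1) * (n * M * (1 + |Λ|) + M)) ≤ C := by
    rw [hC]; gcongr; exact le_add_of_nonneg_left (by positivity)
  calc _ ≤ C * q ^ n + C * (h δ + 1) + C * δ := by gcongr
    _ = _ := by ring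

/-- On `(a,1)` the logarithm is bounded, so each term of the energy density is integrable. -/
theorem IsProfile.integrableOn_bound (hn : 2 ≤ n) (hκ : 0 < κ) (hh : IsVolumetricEnergy h)
    (hp : IsProfile lam r g)
    (hi : IntegrableOn (fun R => modifiedDensity n κ h R (r R) (g R)) (Ioo 0 1))
    {a : ℝ} (ha : a ∈ Ioo (0 : ℝ) 1) :
    IntegrableOn (fun R => R ^ (n - 1) * (g R ^ n + (h (g R * (r R / R) ^ (n - 1)) + 1)
      + g R * (r R / R) ^ (n - 1))) (Ioo a 1) := by
  have hsub : Ioo a 1 ⊆ Ioo 0 1 := Ioo_subset_Ioo_left ha.1.le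
  have hsubc : Icc a 1 ⊆ Icc 0 1 := Icc_subset_Icc_left ha.1.le
  have hn1 : (0 : ℝ) < (n : ℝ) - 1 := by
    have : (2 : ℝ) ≤ n := by exact_mod_cast hn
    linarith
  have hrc := hp.continuousOn.mono hsubc
  have hpos : ∀ x ∈ Icc a 1, 0 < r x := fun x hx => hp.pos ⟨ha.1.trans_le hx.1, hx.2⟩
  have hpos' : ∀ x ∈ Icc a 1, 0 < x := fun x hx => ha.1.trans_le hx.1
  have hgi : IntegrableOn g (Icc a 1) :=
    (integrableOn_Icc_iff_integrableOn_Ioo).2 (hp.integrableOn.mono_set hsub)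
  have hL : ContinuousOn (fun R => κ * ((n : ℝ) - 1) * r R ^ (n - 1) *
      (1 / n + Real.log (r R / R))) (Icc a 1) := by
    refine ((continuousOn_const.mul (hrc.pow _))).mul (continuousOn_const.add
      ((hrc.div continuousOn_id fun x hx => (hpos' x hx).ne').log fun x hx => ?_))
    exact (div_pos (hpos x hx) (hpos' x hx)).ne'
  have i1 := (hgi.continuousOn_mul hL isCompact_Icc).mono_set Ioo_subset_Icc_self
  have i2 := (hgi.continuousOn_mul (hrc.pow (n - 1)) isCompact_Icc).mono_set
    (Ioo_subset_Icc_self)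
  have i3 : IntegrableOn (fun R : ℝ => R ^ (n - 1)) (Ioo a 1) :=
    ((continuous_pow (n - 1)).integrableOn_Icc (a := a) (b := 1)).mono_set Ioo_subset_Icc_self
  have i4 := (hi.mono_set hsub).sub i1
  refine (((i4.const_mul (n / κ + 1)).add i3).add i2).mono' ?_ ?_
  · have m1 := hp.aemeasurable_comp_stretch (n := n) hh.contDiffOn.continuousOn
    have m2 := hp.aemeasurable_deriv
    have m3 := hp.aemeasurable.div (aemeasurable_id (μ := volume.restrict (Ioo (0 : ℝ) 1)))
    have : AEMeasurable (fun R => R ^ (n - 1) * (g R ^ n + (h (g R * (r R / R) ^ (n - 1)) + 1)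
      + g R * (r R / R) ^ (n - 1))) (volume.restrict (Ioo 0 1)) :=
      (aemeasurable_id.pow_const _).mul (((m2.pow_const n).add (m1.add_const 1)).add
        (m2.mul (m3.pow_const _)))
    exact (this.mono_measure (Measure.restrict_mono hsub le_rfl)).aestronglyMeasurable
  · filter_upwards [ae_restrict_of_ae_restrict_of_subset hsub hp.ae_pos,
      ae_restrict_mem measurableSet_Ioo] with R hg hR
    have hR0 := ha.1.trans hR.1
    have hs := hp.pos ⟨hR0, hR.2.le⟩
    have hδ0 : 0 < g R * (r R / R) ^ (n - 1) := by positivity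
    have hh0 := hh.nonneg _ hδ0
    have e : R ^ (n - 1) * (g R * (r R / R) ^ (n - 1)) = r R ^ (n - 1) * g R := by
      rw [div_pow]; field_simp
    rw [Real.norm_of_nonneg (by positivity)]
    simp only [Pi.add_apply, Pi.sub_apply]
    have e2 : modifiedDensity n κ h R (r R) (g R) - κ * ((n : ℝ) - 1) * r R ^ (n - 1) *
      (1 / n + Real.log (r R / R)) * g R =
        R ^ (n - 1) * (κ / n * g R ^ n + h (g R * (r R / R) ^ (n - 1))) := by
      unfold modifiedDensity
      rw [mul_add (R ^ (n - 1)), mul_comm (κ * ((n : ℝ) - 1)) (g R * _), mul_assoc (g R * _),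
        ← mul_assoc (R ^ (n - 1)) (g R * _), e]
      ring
    rw [e2, mul_add (R ^ (n - 1)), e, ← add_assoc (g R ^ n), mul_add (R ^ (n - 1)), mul_one]
    gcongr ?_ + _ + _
    rw [mul_left_comm]
    gcongr
    have hn0 : (n : ℝ) ≠ 0 := by positivity
    have : (n / κ + 1) * (κ / n * g R ^ n + h (g R * (r R / R) ^ (n - 1))) =
      g R ^ n + κ / n * g R ^ n + (n / κ + 1) * h (g R * (r R / R) ^ (n - 1)) := by
      field_simp
    rw [this]
    have t1 : 0 ≤ κ / n * g R ^ n := by positivity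
    have t2 : 0 ≤ n / κ * h (g R * (r R / R) ^ (n - 1)) := by positivity
    linarith

/-! ### The first variation -/

section Variation

variable {θ : ℝ → ℝ} {M a : ℝ}

theorem IsProfile.integrableOn_mul_bdd (hp : IsProfile lam r g) (hθ : Measurable θ)
    (hM : ∀ x, |θ x| ≤ M) : IntegrableOn (fun x => g x * θ x) (Ioo 0 1) :=
  Integrable.mul_bdd hp.integrableOn hθ.aestronglyMeasurable (ae_of_all _ hM)

/-- As `0 ≤ r 0`, the change of `r` is controlled by `r` itself, so relative perturbations of `r'`
are relative perturbations of `r`. -/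
theorem IsProfile.abs_integral_mul_le (hp : IsProfile lam r g) (hM0 : 0 ≤ M)
    (hM : ∀ x, |θ x| ≤ M) {x : ℝ} (hx : x ∈ Icc (0 : ℝ) 1) :
    |∫ t in (0 : ℝ)..x, g t * θ t| ≤ M * r x := by
  have h0 : (0 : ℝ) ∈ Icc (0 : ℝ) 1 := by simp
  have hi := hp.intervalIntegrable_of_mem h0 hx
  calc |∫ t in (0 : ℝ)..x, g t * θ t| ≤ ∫ t in (0 : ℝ)..x, M * g t := by
        rw [← Real.norm_eq_abs]
        refine intervalIntegral.norm_integral_le_of_norm_le hx.1 ?_ (hi.const_mul M)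
        have h1 : ∀ᵐ t : ℝ, t ≠ 1 := by simp [ae_iff]
        filter_upwards [(ae_restrict_iff' measurableSet_Ioo).1 hp.ae_pos, h1] with t ht ht1 htx
        have := ht ⟨htx.1, lt_of_le_of_ne (htx.2.trans hx.2) ht1⟩
        rw [norm_mul, Real.norm_of_nonneg this.le, mul_comm]
        exact mul_le_mul_of_nonneg_right (hM t) this.le
    _ = M * (r x - r 0) := by
        rw [intervalIntegral.integral_const_mul, ← hp.sub_eq_integral h0 hx]
    _ ≤ M * r x := mul_le_mul_of_nonneg_left (by linarith [hp.map_zero_nonneg]) hM0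

/-- Since the derivative is perturbed by a factor close to `1`, the perturbation stays
admissible. -/
theorem IsProfile.add_variation (hp : IsProfile lam r g) (hθ : Measurable θ)
    (hM : ∀ x, |θ x| ≤ M) (hmean : ∫ t in (0 : ℝ)..1, g t * θ t = 0) {ε : ℝ} (hε : |ε| * M < 1) :
    IsProfile lam (fun x => r x + ε * ∫ t in (0 : ℝ)..x, g t * θ t)
      (fun x => g x * (1 + ε * θ x)) := by
  have hgθ := hp.integrableOn_mul_bdd hθ hM
  have hint := intervalIntegrable_of_integrableOn_Ioo zero_le_one hgθ
  have e : (fun x => g x * (1 + ε * θ x)) = fun x => g x + ε * (g x * θ x) := by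
    funext x; ring
  have h0 : (0 : ℝ) ∈ Icc (0 : ℝ) 1 := by simp
  refine ⟨?_, fun x hx => ?_, ?_, ?_, ?_⟩
  · rw [e]
    exact hp.integrableOn.add (hgθ.const_mul ε)
  · rw [e, intervalIntegral.integral_add (hp.intervalIntegrable_of_mem h0 hx)
      ((hint.mono_set (by
        rw [uIcc_of_le zero_le_one]; exact uIcc_subset_Icc h0 hx)).const_mul ε),
      intervalIntegral.integral_const_mul, hp.eq_integral x hx]
    simp
    ring
  · filter_upwards [hp.ae_pos] with x hx
    have : |ε * θ x| < 1 := by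
      rw [abs_mul]
      exact (mul_le_mul_of_nonneg_left (hM x) (abs_nonneg ε)).trans_lt hε
    exact mul_pos hx (by linarith [(abs_lt.1 this).1])
  · simp [hmean, hp.map_one]
  · simpa using hp.map_zero_nonneg

theorem IsProfile.aemeasurable_densityVariation (hh : IsVolumetricEnergy h)
    (hp : IsProfile lam r g) {τ β : ℝ → ℝ} (hτ : AEMeasurable τ (volume.restrict (Ioo 0 1)))
    (hβ : AEMeasurable β (volume.restrict (Ioo 0 1))) :
    AEMeasurable (fun R => densityVariation n κ h R (r R) (g R) (τ R) (β R))
      (volume.restrict (Ioo 0 1)) := by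
  have h1 := hp.aemeasurable_comp_stretch (n := n) hh.continuousOn_deriv
  have h2 := hp.aemeasurable_deriv
  have h3 := hp.aemeasurable.div (aemeasurable_id (μ := volume.restrict (Ioo (0 : ℝ) 1)))
  have h4 : AEMeasurable (fun R : ℝ => Real.log (r R / R)) (volume.restrict (Ioo 0 1)) := h3.log
  have h5 : AEMeasurable (fun R => τ R + ((n : ℝ) - 1) * β R) (volume.restrict (Ioo 0 1)) :=
    hτ.add (hβ.const_mul _)
  have h6 : AEMeasurable (fun R => g R * (r R / R) ^ (n - 1)) (volume.restrict (Ioo 0 1)) :=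
    h2.mul (h3.pow_const _)
  unfold densityVariation
  exact (aemeasurable_id.pow_const _).mul (((((h2.pow_const n).const_mul _).mul hτ).add
    (h5.mul (h6.mul h1))).add ((h6.const_mul _).mul ((h5.mul (h4.const_add _)).add hβ)))

theorem IsProfile.exists_abs_log_le (hp : IsProfile lam r g) (ha : a ∈ Ioo (0 : ℝ) 1) :
    ∃ Λ, ∀ R ∈ Ioo a 1, |Real.log (r R / R)| ≤ Λ := by
  have hsub : Icc a 1 ⊆ Icc 0 1 := Icc_subset_Icc_left ha.1.le
  have : ContinuousOn (fun R => Real.log (r R / R)) (Icc a 1) := by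
    refine ((hp.continuousOn.mono hsub).div continuousOn_id fun x hx =>
      (ha.1.trans_le hx.1).ne').log fun x hx => ?_
    exact (div_pos (hp.pos ⟨ha.1.trans_le hx.1, hx.2⟩) (ha.1.trans_le hx.1)).ne'
  obtain ⟨C, hC⟩ := isCompact_Icc.exists_bound_of_continuousOn this
  exact ⟨C, fun R hR => hC R (Ioo_subset_Icc_self hR)⟩

theorem abs_log_one_add_le {x : ℝ} (hx : |x| ≤ 1 / 2) : |Real.log (1 + x)| ≤ 1 := by
  obtain ⟨h1, h2⟩ := abs_le.1 hx
  have hpos : 0 < 1 + x := by linarith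
  have h3 := Real.log_le_sub_one_of_pos hpos
  have h4 := Real.one_sub_inv_le_log_of_pos hpos
  have h5 : (1 + x)⁻¹ ≤ 2 := by
    rw [inv_le_comm₀ hpos two_pos]; linarith
  exact abs_le.2 ⟨by linarith, by linarith⟩

theorem abs_div_one_add_le {t x : ℝ} (ht : |t| ≤ M) (hx : |x| ≤ 1 / 2) :
    |t / (1 + x)| ≤ 2 * M := by
  have hpos : 0 < 1 + x := by linarith [(abs_le.1 hx).1]
  rw [abs_div, abs_of_pos hpos, div_le_iff₀ hpos]
  have h0 : 0 ≤ M := (abs_nonneg t).trans ht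
  nlinarith [(abs_le.1 hx).1]

/-- **The weak Euler-Lagrange equation.** A minimizing profile makes the energy stationary under
the variations `r' ↦ r' (1 + ε θ)`, where `θ` is bounded, vanishes near `0` and preserves the
boundary value at `1`. -/
theorem IsProfile.integral_densityVariation_eq_zero (hn : 2 ≤ n) (hκ : 0 < κ)
    (hh : IsVolumetricEnergy h) (hgrowth : DerivGrowth h) (hp : IsProfile lam r g)
    (hi : IntegrableOn (fun R => modifiedDensity n κ h R (r R) (g R)) (Ioo 0 1))
    (hmin : ∀ ρ γ : ℝ → ℝ, IsProfile lam ρ γ →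
        IntegrableOn (fun R => modifiedDensity n κ h R (ρ R) (γ R)) (Ioo 0 1) →
        ∫ R in Ioo (0 : ℝ) 1, modifiedDensity n κ h R (r R) (g R) ≤
          ∫ R in Ioo (0 : ℝ) 1, modifiedDensity n κ h R (ρ R) (γ R))
    (ha : a ∈ Ioo (0 : ℝ) 1) (hθ : Measurable θ) (hM0 : 0 < M) (hM : ∀ x, |θ x| ≤ M)
    (hθa : ∀ x ≤ a, θ x = 0) (hmean : ∫ t in (0 : ℝ)..1, g t * θ t = 0) :
    ∫ R in Ioo (0 : ℝ) 1, densityVariation n κ h R (r R) (g R) (θ R)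
      ((∫ t in (0 : ℝ)..R, g t * θ t) / r R) = 0 := by
  obtain ⟨Λ, hΛ⟩ := hp.exists_abs_log_le ha
  obtain ⟨C, hC0, η, hη0, hη2, hC⟩ := exists_abs_densityVariation_le (M := 2 * M) (Λ := Λ + 1)
    hn hκ hh hgrowth (by positivity)
  set φ : ℝ → ℝ := fun x => ∫ t in (0 : ℝ)..x, g t * θ t with hφ
  set ε₀ := η / M with hε₀
  have hε₀0 : 0 < ε₀ := by positivity
  have hφa : ∀ x ≤ a, 0 < x → φ x = 0 := fun x hx hx0 => by
    refine (intervalIntegral.integral_congr (g := fun _ => 0) fun t ht => ?_).trans (by simp)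
    rw [uIcc_of_le hx0.le] at ht
    simp [hθa t (ht.2.trans hx)]
  have hφr : ∀ x ∈ Ioo (0 : ℝ) 1, |φ x / r x| ≤ M := fun x hx => by
    have hr0 := hp.pos ⟨hx.1, hx.2.le⟩
    rw [abs_div, abs_of_pos hr0, div_le_iff₀ hr0]
    exact hp.abs_integral_mul_le hM0.le hM (Ioo_subset_Icc_self hx)
  have hsmall : ∀ ε ∈ Metric.ball (0 : ℝ) ε₀, ∀ t : ℝ, |t| ≤ M → |ε * t| ≤ η := by
    intro ε hε t ht
    rw [mem_ball_zero_iff, Real.norm_eq_abs, hε₀, lt_div_iff₀ hM0] at hε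
    rw [abs_mul]
    exact (mul_le_mul_of_nonneg_left ht (abs_nonneg ε)).trans hε.le
  set F : ℝ → ℝ → ℝ := fun ε R => modifiedDensity n κ h R (r R + ε * φ R) (g R * (1 + ε * θ R))
    with hF
  set F' : ℝ → ℝ → ℝ := fun ε R => densityVariation n κ h R (r R + ε * φ R)
    (g R * (1 + ε * θ R)) (θ R / (1 + ε * θ R)) (φ R / r R / (1 + ε * (φ R / r R))) with hF'
  set bound : ℝ → ℝ := (Ioo a 1).indicator fun R => C * (R ^ (n - 1) * (g R ^ n +
    (h (g R * (r R / R) ^ (n - 1)) + 1) + g R * (r R / R) ^ (n - 1))) with hbd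
  have hprof : ∀ ε ∈ Metric.ball (0 : ℝ) ε₀,
      IsProfile lam (fun x => r x + ε * φ x) (fun x => g x * (1 + ε * θ x)) := by
    intro ε hε
    refine hp.add_variation hθ hM hmean ?_
    rw [mem_ball_zero_iff, Real.norm_eq_abs, hε₀, lt_div_iff₀ hM0] at hε
    linarith
  have hFm : ∀ ε ∈ Metric.ball (0 : ℝ) ε₀,
      AEStronglyMeasurable (F ε) (volume.restrict (Ioo 0 1)) := fun ε hε =>
    ((hprof ε hε).aemeasurable_modifiedDensity hh).aestronglyMeasurable
  have hF0 : F 0 = fun R => modifiedDensity n κ h R (r R) (g R) := by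
    funext R; simp [hF]
  have hFi : IntegrableOn (F 0) (Ioo 0 1) := by rwa [hF0]
  have hbi : IntegrableOn bound (Ioo 0 1) := by
    rw [hbd, IntegrableOn, integrable_indicator_iff measurableSet_Ioo, IntegrableOn,
      Measure.restrict_restrict measurableSet_Ioo,
      inter_eq_left.2 (Ioo_subset_Ioo_left ha.1.le)]
    exact (hp.integrableOn_bound hn hκ hh hi ha).const_mul C
  have hbound : ∀ᵐ R ∂volume.restrict (Ioo (0 : ℝ) 1), ∀ ε ∈ Metric.ball (0 : ℝ) ε₀,
      ‖F' ε R‖ ≤ bound R := by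
    filter_upwards [hp.ae_pos, ae_restrict_mem measurableSet_Ioo] with R hg hR ε hε
    have hr0 := hp.pos ⟨hR.1, hR.2.le⟩
    rcases le_or_gt R a with hRa | hRa
    · have : R ∉ Ioo a 1 := fun h => absurd h.1 (not_lt.2 hRa)
      simp [hF', hbd, this, hθa R hRa, hφa R hRa hR.1, densityVariation]
    · have hR' : R ∈ Ioo a 1 := ⟨hRa, hR.2⟩
      have hx := hsmall ε hε _ (hφr R hR)
      have hy := hsmall ε hε _ (hM R)
      have hx0 : 0 < 1 + ε * (φ R / r R) := by linarith [(abs_le.1 hx).1]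
      rw [hbd, indicator_of_mem hR', Real.norm_eq_abs]
      have e : r R + ε * φ R = r R * (1 + ε * (φ R / r R)) := by field_simp
      simp only [hF']
      rw [e]
      refine hC R (r R) (g R) _ _ _ _ hR.1 hr0 hg hx hy ?_
        (abs_div_one_add_le (hM R) (hy.trans hη2))
        (abs_div_one_add_le (hφr R hR) (hx.trans hη2))
      rw [show r R * (1 + ε * (φ R / r R)) / R = r R / R * (1 + ε * (φ R / r R)) by ring,
        Real.log_mul (div_pos hr0 hR.1).ne' hx0.ne']
      exact (abs_add_le _ _).trans (add_le_add (hΛ R hR') (abs_log_one_add_le (hx.trans hη2)))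
  have hdiff : ∀ᵐ R ∂volume.restrict (Ioo (0 : ℝ) 1), ∀ ε ∈ Metric.ball (0 : ℝ) ε₀,
      HasDerivAt (F · R) (F' ε R) ε := by
    filter_upwards [hp.ae_pos, ae_restrict_mem measurableSet_Ioo] with R hg hR ε hε
    have hr0 := hp.pos ⟨hR.1, hR.2.le⟩
    have hx := hsmall ε hε _ (hφr R hR)
    have hy := hsmall ε hε _ (hM R)
    have hx0 : 0 < 1 + ε * (φ R / r R) := by linarith [(abs_le.1 hx).1]
    have hy0 : 0 < 1 + ε * θ R := by linarith [(abs_le.1 hy).1]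
    have e : r R + ε * φ R = r R * (1 + ε * (φ R / r R)) := by field_simp
    have key : ∀ u x t : ℝ, 0 < x → u * x * (t / x) = u * t := fun u x t hx => by field_simp
    refine hasDerivAt_modifiedDensity (S := fun ε => r R + ε * φ R)
      (Q := fun ε => g R * (1 + ε * θ R)) hn hh hR.1 (by rw [e]; positivity) (by positivity) ?_ ?_
    · refine (((hasDerivAt_id ε).mul_const (φ R)).const_add (r R)).congr_deriv ?_
      rw [e, key _ _ _ hx0]; field_simp
    · refine ((((hasDerivAt_id ε).mul_const (θ R)).const_add 1).const_mul (g R)).congr_deriv ?_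
      rw [key _ _ _ hy0, one_mul]
  have hball : Metric.ball (0 : ℝ) ε₀ ∈ 𝓝 (0 : ℝ) := Metric.ball_mem_nhds _ hε₀0
  have hF'0 : F' 0 = fun R => densityVariation n κ h R (r R) (g R) (θ R) (φ R / r R) := by
    funext R; simp [hF']
  have hφm : AEMeasurable φ (volume.restrict (Ioo 0 1)) := by
    have := (intervalIntegrable_of_integrableOn_Ioo zero_le_one
      (hp.integrableOn_mul_bdd hθ hM)).absolutelyContinuousOnInterval_intervalIntegral
      (c := 0) left_mem_uIcc |>.continuousOn
    rw [uIcc_of_le zero_le_one] at this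
    exact (this.mono Ioo_subset_Icc_self).aemeasurable measurableSet_Ioo
  have hder := (hasDerivAt_integral_of_dominated_loc_of_deriv_le hball
    (eventually_of_mem hball hFm) hFi (F' := F') (by
      rw [hF'0]
      exact (hp.aemeasurable_densityVariation hh hθ.aemeasurable
        (hφm.div hp.aemeasurable)).aestronglyMeasurable) hbound hbi hdiff).2
  have hloc : IsLocalMin (fun ε => ∫ R in Ioo (0 : ℝ) 1, F ε R) 0 := by
    filter_upwards [hball] with ε hε
    rw [hF0]
    refine hmin _ _ (hprof ε hε) ?_
    -- integrability of the perturbed density, by the mean value inequality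
    have hd : IntegrableOn (fun R => F ε R - F 0 R) (Ioo 0 1) := by
      refine (hbi.mul_const ‖ε - 0‖).mono' ((hFm ε hε).sub hFi.aestronglyMeasurable) ?_
      filter_upwards [hbound, hdiff] with R hb hd
      exact (convex_ball (0 : ℝ) ε₀).norm_image_sub_le_of_norm_hasDerivWithin_le
        (fun e he => (hd e he).hasDerivWithinAt) hb (Metric.mem_ball_self hε₀0) hε
    have := hd.add hFi
    refine this.congr (ae_of_all _ fun R => ?_)
    simp [hF]
  have := hloc.hasDerivAt_eq_zero hder
  rwa [hF'0] at this

end Variation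

/-! ### The integrated Euler-Lagrange equation -/

/-- The partial derivative of the modified density with respect to `q = r'`, for `R > 0`. -/
noncomputable def momentum (n : ℕ) (κ : ℝ) (h : ℝ → ℝ) (R s q : ℝ) : ℝ :=
  κ * R ^ (n - 1) * q ^ (n - 1) + s ^ (n - 1) * deriv h (q * (s / R) ^ (n - 1))
    + κ * ((n : ℝ) - 1) * s ^ (n - 1) * (1 / n + Real.log (s / R))

/-- The partial derivative of the modified density with respect to `s = r`, for `R, s > 0`. -/
noncomputable def force (n : ℕ) (κ : ℝ) (h : ℝ → ℝ) (R s q : ℝ) : ℝ :=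
  ((n : ℝ) - 1) * q * s ^ (n - 2) * (deriv h (q * (s / R) ^ (n - 1))
    + κ * ((n : ℝ) - 1) * (1 / n + Real.log (s / R)) + κ)

theorem densityVariation_eq (hn : 2 ≤ n) {R s q τ β : ℝ} (hR : 0 < R) :
    densityVariation n κ h R s q τ β =
      momentum n κ h R s q * (q * τ) + force n κ h R s q * (s * β) := by
  have e1 : q ^ n = q ^ (n - 1) * q := by
    rw [← pow_succ, Nat.sub_add_cancel (by omega)]
  have e2 : s ^ (n - 1) = s ^ (n - 2) * s := by
    rw [← pow_succ]; congr 1; omega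
  have e3 : R ^ (n - 1) * (s / R) ^ (n - 1) = s ^ (n - 2) * s := by
    rw [← mul_pow, mul_div_cancel₀ _ hR.ne', e2]
  unfold densityVariation momentum force
  set d := deriv h (q * (s / R) ^ (n - 1))
  set L := 1 / (n : ℝ) + Real.log (s / R)
  rw [e2, e1]
  linear_combination (q * d * (τ + ((n : ℝ) - 1) * β) + κ * ((n : ℝ) - 1) * q *
    ((τ + ((n : ℝ) - 1) * β) * L + β)) * e3

theorem IsProfile.integrableOn_densityVariation (hn : 2 ≤ n) (hκ : 0 < κ)
    (hh : IsVolumetricEnergy h) (hgrowth : DerivGrowth h) (hp : IsProfile lam r g)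
    (hi : IntegrableOn (fun R => modifiedDensity n κ h R (r R) (g R)) (Ioo 0 1))
    {a τ β : ℝ} (ha : a ∈ Ioo (0 : ℝ) 1) (hτ : |τ| ≤ 1) (hβ : |β| ≤ 1) :
    IntegrableOn (fun R => densityVariation n κ h R (r R) (g R) τ β) (Ioo a 1) := by
  have hsub : Ioo a 1 ⊆ Ioo 0 1 := Ioo_subset_Ioo_left ha.1.le
  obtain ⟨Λ, hΛ⟩ := hp.exists_abs_log_le ha
  obtain ⟨C, -, η, hη, -, hC⟩ := exists_abs_densityVariation_le (M := 1) (Λ := Λ)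
    hn hκ hh hgrowth zero_le_one
  refine ((hp.integrableOn_bound hn hκ hh hi ha).const_mul C).mono'
    ((hp.aemeasurable_densityVariation hh aemeasurable_const aemeasurable_const).mono_measure
      (Measure.restrict_mono hsub le_rfl)).aestronglyMeasurable ?_
  filter_upwards [ae_restrict_of_ae_restrict_of_subset hsub hp.ae_pos,
      ae_restrict_mem measurableSet_Ioo] with R hg hR
  have hR0 := ha.1.trans hR.1
  simpa using hC R (r R) (g R) 0 0 τ β hR0 (hp.pos ⟨hR0, hR.2.le⟩) hg (by simpa using hη.le)
    (by simpa using hη.le) (by simpa using hΛ R hR) hτ hβ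

/-- The du Bois-Reymond lemma with weight `g > 0`: a function orthogonal, in the weighted `L²`
pairing, to all bounded functions of weighted mean zero is constant. -/
theorem exists_ae_eq_const_of_forall_integral_mul_eq_zero {f g : ℝ → ℝ} {a b : ℝ} (hab : a < b)
    (hg : IntegrableOn g (Ioo a b)) (hpos : ∀ᵐ x ∂volume.restrict (Ioo a b), 0 < g x)
    (hfg : IntegrableOn (fun x => f x * g x) (Ioo a b))
    (H : ∀ θ : ℝ → ℝ, Measurable θ → (∃ M, ∀ x, |θ x| ≤ M) → (∀ x ∉ Ioo a b, θ x = 0) →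
      ∫ x in Ioo a b, g x * θ x = 0 → ∫ x in Ioo a b, f x * (g x * θ x) = 0) :
    ∃ c, ∀ᵐ x ∂volume.restrict (Ioo a b), f x = c := by
  set G := ∫ x in Ioo a b, g x with hG
  have hG0 : 0 < G := by
    rw [hG, setIntegral_pos_iff_support_of_nonneg_ae (hpos.mono fun x hx => hx.le) hg]
    refine lt_of_lt_of_le (b := volume (Ioo a b)) (by simpa using hab) (measure_mono_ae ?_)
    filter_upwards [(ae_restrict_iff' measurableSet_Ioo).1 hpos] with t ht hxt
    exact ⟨(ht hxt).ne', hxt⟩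
  set c := (∫ x in Ioo a b, f x * g x) / G with hc
  have hfc : IntegrableOn (fun x => f x * g x - c * g x) (Ioo a b) := hfg.sub (hg.const_mul c)
  refine ⟨c, ?_⟩
  have key := Integrable.ae_eq_zero_of_forall_setIntegral_eq_zero hfc fun S hS _ => ?_
  · filter_upwards [key, hpos] with x hx hgx
    have : (f x - c) * g x = 0 := by simpa [sub_mul] using hx
    rcases mul_eq_zero.1 this with h | h
    · linarith
    · exact absurd h hgx.ne'
  · set m := (∫ x in Ioo a b, S.indicator g x) / G with hm
    have hgS : IntegrableOn (S.indicator g) (Ioo a b) := Integrable.indicator hg hS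
    have hfS : IntegrableOn (S.indicator fun x => f x * g x) (Ioo a b) := Integrable.indicator hfg hS
    set θ : ℝ → ℝ := (Ioo a b).indicator fun x => S.indicator 1 x - m with hθ
    have e1 : EqOn (fun x => g x * θ x) (fun x => S.indicator g x - m * g x) (Ioo a b) := by
      intro x hx
      by_cases hxS : x ∈ S <;> simp [hθ, hx, hxS] <;> ring
    have e2 : EqOn (fun x => f x * (g x * θ x))
        (fun x => S.indicator (fun x => f x * g x) x - m * (f x * g x)) (Ioo a b) := by
      intro x hx
      by_cases hxS : x ∈ S <;> simp [hθ, hx, hxS] <;> ring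
    have h1 := H θ (((measurable_one.indicator hS).sub_const m).indicator measurableSet_Ioo)
      ⟨1 + |m|, fun x => by
        by_cases hx : x ∈ Ioo a b
        · rw [hθ, indicator_of_mem hx]
          refine (abs_sub _ _).trans (add_le_add ?_ le_rfl)
          by_cases hxS : x ∈ S <;> simp [hxS]
        · rw [hθ, indicator_of_notMem hx, abs_zero]; positivity⟩
      (fun x hx => by rw [hθ, indicator_of_notMem hx]) (by
        rw [setIntegral_congr_fun measurableSet_Ioo e1, integral_sub hgS (hg.const_mul m),
          integral_const_mul, ← hG, hm]
        field_simp
        ring)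
    rw [setIntegral_congr_fun measurableSet_Ioo e2, integral_sub hfS (hfg.const_mul m),
      integral_const_mul] at h1
    rw [← integral_indicator hS]
    have e3 : ∀ x, S.indicator (fun x => f x * g x - c * g x) x =
        S.indicator (fun x => f x * g x) x - c * S.indicator g x := by
      intro x
      by_cases hxS : x ∈ S <;> simp [hxS]
    simp only [e3]
    rw [integral_sub hfS (hgS.const_mul c), integral_const_mul]
    have e4 : ∫ x in Ioo a b, f x * g x = c * G := by rw [hc]; field_simp
    have e5 : ∫ x in Ioo a b, S.indicator g x = m * G := by rw [hm]; field_simp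
    rw [e4] at h1
    rw [e5]
    linarith

/-- **The integrated Euler-Lagrange equation.** On `(a,1)` the momentum of a minimizing profile is,
almost everywhere, a constant plus the primitive of the force. -/
theorem IsProfile.exists_momentum_ae_eq (hn : 2 ≤ n) (hκ : 0 < κ)
    (hh : IsVolumetricEnergy h) (hgrowth : DerivGrowth h) (hp : IsProfile lam r g)
    (hi : IntegrableOn (fun R => modifiedDensity n κ h R (r R) (g R)) (Ioo 0 1))
    (hmin : ∀ ρ γ : ℝ → ℝ, IsProfile lam ρ γ →
        IntegrableOn (fun R => modifiedDensity n κ h R (ρ R) (γ R)) (Ioo 0 1) →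
        ∫ R in Ioo (0 : ℝ) 1, modifiedDensity n κ h R (r R) (g R) ≤
          ∫ R in Ioo (0 : ℝ) 1, modifiedDensity n κ h R (ρ R) (γ R))
    {a : ℝ} (ha : a ∈ Ioo (0 : ℝ) 1) :
    IntegrableOn (fun R => force n κ h R (r R) (g R)) (Ioo a 1) ∧
      ∃ c, ∀ᵐ R ∂volume.restrict (Ioo a 1), momentum n κ h R (r R) (g R) =
        c + ∫ t in a..R, force n κ h t (r t) (g t) := by
  have hsub : Ioo a 1 ⊆ Ioo 0 1 := Ioo_subset_Ioo_left ha.1.le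
  set A : ℝ → ℝ := fun R => momentum n κ h R (r R) (g R) with hA
  set B : ℝ → ℝ := fun R => force n κ h R (r R) (g R) with hB
  have hrc : ContinuousOn r (Icc a 1) := hp.continuousOn.mono (Icc_subset_Icc_left ha.1.le)
  have hr0 : ∀ x ∈ Icc a 1, 0 < r x := fun x hx => hp.pos ⟨ha.1.trans_le hx.1, hx.2⟩
  have hgi : IntegrableOn g (Ioo a 1) := hp.integrableOn.mono_set hsub
  have hAi : IntegrableOn (fun R => A R * g R) (Ioo a 1) := by
    refine (hp.integrableOn_densityVariation hn hκ hh hgrowth hi (τ := 1) (β := 0) ha (by simp)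
      (by simp)).congr_fun (fun R hR => ?_) measurableSet_Ioo
    simp [densityVariation_eq hn (ha.1.trans hR.1), hA]
  have hBi : IntegrableOn B (Ioo a 1) := by
    have h1 := (hp.integrableOn_densityVariation hn hκ hh hgrowth hi (τ := 0) (β := 1) ha (by simp)
      (by simp))
    have h2 := (((integrableOn_Icc_iff_integrableOn_Ioo).2 h1).continuousOn_mul
      (hrc.inv₀ fun x hx => (hr0 x hx).ne') isCompact_Icc).mono_set Ioo_subset_Icc_self
    refine h2.congr_fun (fun R hR => ?_) measurableSet_Ioo
    have := hr0 R (Ioo_subset_Icc_self hR)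
    simp only [densityVariation_eq hn (ha.1.trans hR.1), hB, Pi.inv_apply]
    field_simp
    ring
  refine ⟨hBi, ?_⟩
  have hBii := intervalIntegrable_of_integrableOn_Ioo ha.2.le hBi
  have hP := hBii.absolutelyContinuousOnInterval_intervalIntegral (c := a) left_mem_uIcc
    |>.continuousOn
  rw [uIcc_of_le ha.2.le] at hP
  have hPg : IntegrableOn (fun R => (∫ t in a..R, B t) * g R) (Ioo a 1) :=
    (((integrableOn_Icc_iff_integrableOn_Ioo).2 hgi).continuousOn_mul hP
      isCompact_Icc).mono_set Ioo_subset_Icc_self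
  obtain ⟨c, hc⟩ := exists_ae_eq_const_of_forall_integral_mul_eq_zero
    (f := fun R => A R - ∫ t in a..R, B t) (g := g) ha.2 hgi
    (ae_restrict_of_ae_restrict_of_subset hsub hp.ae_pos) (by
      simp only [sub_mul]; exact hAi.sub hPg) (by
    rintro θ hθm ⟨M, hM⟩ hθ0 hmean
    have hM' : ∀ x, |θ x| ≤ |M| + 1 := fun x => (hM x).trans (by linarith [le_abs_self M])
    have hgθ := hp.integrableOn_mul_bdd hθm hM
    have hgθi := intervalIntegrable_of_integrableOn_Ioo zero_le_one hgθ
    have hgθa := intervalIntegrable_of_integrableOn_Ioo ha.2.le (hgθ.mono_set hsub)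
    have hθa : ∀ x ≤ a, θ x = 0 := fun x hx => hθ0 x fun h => absurd h.1 (not_lt.2 hx)
    have hz : ∀ x ≤ a, 0 ≤ x → ∫ t in (0 : ℝ)..x, g t * θ t = 0 := fun x hx hx0 => by
      refine (intervalIntegral.integral_congr (g := fun _ => 0) fun t ht => ?_).trans (by simp)
      rw [uIcc_of_le hx0] at ht
      simp [hθa t (ht.2.trans hx)]
    have hshift : ∀ x ∈ Icc a 1, ∫ t in (0 : ℝ)..x, g t * θ t = ∫ t in a..x, g t * θ t := by
      intro x hx
      rw [← intervalIntegral.integral_add_adjacent_intervals (b := a), hz a le_rfl ha.1.le, zero_add]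
      · exact hgθi.mono_set (by
          rw [uIcc_of_le zero_le_one, uIcc_of_le ha.1.le]; exact Icc_subset_Icc_right ha.2.le)
      · exact hgθi.mono_set (by
          rw [uIcc_of_le zero_le_one, uIcc_of_le hx.1]; exact Icc_subset_Icc ha.1.le hx.2)
    rw [setIntegral_Ioo_eq_intervalIntegral ha.2.le] at hmean
    have hEL := hp.integral_densityVariation_eq_zero hn hκ hh hgrowth hi hmin ha hθm
      (M := |M| + 1) (by positivity) hM' hθa (by rw [hshift 1 ⟨ha.2.le, le_rfl⟩, hmean])
    -- the variation vanishes on `(0, a]`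
    rw [setIntegral_eq_of_subset_of_forall_sdiff_eq_zero measurableSet_Ioo hsub (by
      rintro x ⟨hx, hxn⟩
      have hxa : x ≤ a := by
        by_contra hlt
        exact hxn ⟨not_le.1 hlt, hx.2⟩
      rw [hz x hxa hx.1.le, hθa x hxa]
      simp [densityVariation]),
      setIntegral_congr_fun (g := fun R => A R * (g R * θ R) +
        (∫ t in a..R, g t * θ t) * B R) measurableSet_Ioo (by
      intro R hR
      have := hr0 R (Ioo_subset_Icc_self hR)
      simp only [densityVariation_eq hn (ha.1.trans hR.1), hA, hB,
        hshift R (Ioo_subset_Icc_self hR)]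
      field_simp)] at hEL
    have hAθ : IntegrableOn (fun R => A R * (g R * θ R)) (Ioo a 1) := by
      simp only [← mul_assoc]
      exact Integrable.mul_bdd hAi hθm.aestronglyMeasurable (ae_of_all _ hM)
    have hPθ : IntegrableOn (fun R => (∫ t in a..R, B t) * (g R * θ R)) (Ioo a 1) := by
      simp only [← mul_assoc]
      exact Integrable.mul_bdd hPg hθm.aestronglyMeasurable (ae_of_all _ hM)
    have hφB : IntegrableOn (fun R => (∫ t in a..R, g t * θ t) * B R) (Ioo a 1) := by
      have hc := hgθa.absolutelyContinuousOnInterval_intervalIntegral (c := a) left_mem_uIcc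
        |>.continuousOn
      rw [uIcc_of_le ha.2.le] at hc
      exact (((integrableOn_Icc_iff_integrableOn_Ioo).2 hBi).continuousOn_mul hc
        isCompact_Icc).mono_set Ioo_subset_Icc_self
    rw [integral_add hAθ hφB, setIntegral_Ioo_eq_intervalIntegral ha.2.le
      (fun R => (∫ t in a..R, g t * θ t) * B R), integral_primitive_mul hgθa hBii, hmean,
      zero_mul, zero_sub] at hEL
    simp only [sub_mul]
    rw [integral_sub hAθ hPθ, setIntegral_Ioo_eq_intervalIntegral ha.2.le
      (fun R => (∫ t in a..R, B t) * (g R * θ R))]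
    simp only [mul_comm (∫ t in a.._, B t)]
    linarith)
  refine ⟨c, hc.mono fun R hR => ?_⟩
  linarith

/-! ### Regularity: inverting the momentum -/

theorem IsVolumetricEnergy.strictMonoOn_deriv (hh : IsVolumetricEnergy h) :
    StrictMonoOn (deriv h) (Ioi 0) :=
  strictMonoOn_of_deriv_pos (convex_Ioi 0) hh.continuousOn_deriv fun d hd =>
    hh.deriv_deriv_pos d (by simpa using hd)

theorem strictMonoOn_momentum (hκ : 0 < κ) (hh : IsVolumetricEnergy h)
    {R s : ℝ} (hR : 0 < R) (hs : 0 < s) : StrictMonoOn (momentum n κ h R s) (Ioi 0) := by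
  intro p hp q hq hpq
  have hp0 : 0 < p := hp
  have hq0 : 0 < q := hq
  have hlt : deriv h (p * (s / R) ^ (n - 1)) < deriv h (q * (s / R) ^ (n - 1)) :=
    hh.strictMonoOn_deriv (mem_Ioi.2 (by positivity)) (mem_Ioi.2 (by positivity)) (by gcongr)
  have hle : p ^ (n - 1) ≤ q ^ (n - 1) := pow_le_pow_left₀ hp0.le hpq.le _
  have h1 := mul_lt_mul_of_pos_left hlt (pow_pos hs (n - 1))
  have h2 := mul_le_mul_of_nonneg_left hle (mul_nonneg hκ.le (pow_nonneg hR.le (n - 1)))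
  unfold momentum
  linarith

theorem continuousOn_momentum_comp (hh : IsVolumetricEnergy h) {S Q : ℝ → ℝ} {U : Set ℝ}
    (hU : ∀ R ∈ U, 0 < R) (hS : ContinuousOn S U) (hS0 : ∀ R ∈ U, 0 < S R)
    (hQ : ContinuousOn Q U) (hQ0 : ∀ R ∈ U, 0 < Q R) :
    ContinuousOn (fun R => momentum n κ h R (S R) (Q R)) U ∧
      ContinuousOn (fun R => force n κ h R (S R) (Q R)) U := by
  have h1 : ContinuousOn (fun R => S R / R) U := hS.div continuousOn_id fun R hR => (hU R hR).ne'
  have h2 : ContinuousOn (fun R => deriv h (Q R * (S R / R) ^ (n - 1))) U :=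
    hh.continuousOn_deriv.comp (hQ.mul (h1.pow _)) fun R hR => by
      have := hU R hR
      have := hS0 R hR
      have := hQ0 R hR
      exact mem_Ioi.2 (by positivity)
  have h3 : ContinuousOn (fun R => 1 / (n : ℝ) + Real.log (S R / R)) U :=
    continuousOn_const.add (h1.log fun R hR => (div_pos (hS0 R hR) (hU R hR)).ne')
  unfold momentum force
  exact ⟨(((continuousOn_const.mul (continuousOn_id.pow _)).mul (hQ.pow _)).add
      ((hS.pow _).mul h2)).add ((continuousOn_const.mul (hS.pow _)).mul h3),
    ((continuousOn_const.mul hQ).mul (hS.pow _)).mul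
      ((h2.add (continuousOn_const.mul h3)).add continuousOn_const)⟩

/-- The limits of `h'` at `0` and at infinity make the momentum onto. -/
theorem exists_momentum_eq (hκ : 0 < κ) (hh : IsVolumetricEnergy h)
    {R s : ℝ} (hR : 0 < R) (hs : 0 < s) (y : ℝ) : ∃ q > 0, momentum n κ h R s q = y := by
  have ht : 0 < (s / R) ^ (n - 1) := by positivity
  have hsn : 0 < s ^ (n - 1) := by positivity
  have hcont : ContinuousOn (momentum n κ h R s) (Ioi 0) := by
    have hmul : ContinuousOn (fun q : ℝ => deriv h (q * (s / R) ^ (n - 1))) (Ioi 0) :=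
      hh.continuousOn_deriv.comp (by fun_prop) fun q hq => mul_pos hq ht
    unfold momentum
    fun_prop
  have hbot : Tendsto (momentum n κ h R s) (𝓝[>] 0) atBot := by
    have h1 : Tendsto (fun q : ℝ => q * (s / R) ^ (n - 1)) (𝓝[>] 0) (𝓝[>] 0) := by
      refine tendsto_nhdsWithin_iff.2 ⟨?_, ?_⟩
      · have : Tendsto (fun q : ℝ => q * (s / R) ^ (n - 1)) (𝓝 0) (𝓝 (0 * (s / R) ^ (n - 1))) :=
          (continuous_id.mul continuous_const).tendsto 0
        rw [zero_mul] at this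
        exact this.mono_left nhdsWithin_le_nhds
      · filter_upwards [self_mem_nhdsWithin] with q hq
        exact mul_pos hq ht
    have h2 := (hh.tendsto_deriv_zero.comp h1).const_mul_atBot hsn
    have h3 : Tendsto (fun q : ℝ => κ * R ^ (n - 1) * q ^ (n - 1)) (𝓝[>] 0)
        (𝓝 (κ * R ^ (n - 1) * 0 ^ (n - 1))) :=
      ((continuous_const.mul (continuous_pow _)).tendsto 0).mono_left nhdsWithin_le_nhds
    exact (h3.add_atBot h2).atBot_add tendsto_const_nhds
  have htop : Tendsto (momentum n κ h R s) atTop atTop := by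
    have h2 := (hh.tendsto_deriv_atTop.comp (tendsto_id.atTop_mul_const ht)).const_mul_atTop hsn
    refine (tendsto_atTop_mono' atTop ?_ h2).atTop_add tendsto_const_nhds
    filter_upwards [eventually_gt_atTop 0] with q hq
    exact le_add_of_nonneg_left (by positivity)
  obtain ⟨p, hpy, hp⟩ := ((hbot.eventually_lt_atBot y).and self_mem_nhdsWithin).exists
  obtain ⟨q, hqy, hq⟩ := ((htop.eventually_gt_atTop y).and (eventually_gt_atTop 0)).exists
  obtain ⟨z, hz, hzy⟩ := isPreconnected_Ioi.intermediate_value hp hq hcont ⟨hpy.le, hqy.le⟩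
  exact ⟨z, hz, hzy⟩

theorem hasDerivWithinAt_of_eq_integral {F f : ℝ → ℝ} {a b : ℝ} (hab : a ≤ b)
    (hf : ContinuousOn f (Icc a b)) (hF : ∀ x ∈ Icc a b, F x = F a + ∫ t in a..x, f t) :
    ∀ x ∈ Icc a b, HasDerivWithinAt F (f x) (Icc a b) x := by
  intro x hx
  set f' := IccExtend hab ((Icc a b).domRestrict f) with hf'
  have hc : Continuous f' := (continuousOn_iff_continuous_domRestrict.1 hf).Icc_extend'
  have he : ∀ t ∈ Icc a b, f' t = f t := fun t ht => by
    rw [hf', IccExtend_of_mem hab _ ht]; rfl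
  have := ((hc.integral_hasStrictDerivAt a x).hasDerivAt.const_add (F a)).hasDerivWithinAt
    (s := Icc a b)
  rw [he x hx] at this
  have hF' : ∀ y ∈ Icc a b, F y = F a + ∫ t in a..y, f' t := fun y hy => by
    rw [hF y hy]
    congr 1
    refine intervalIntegral.integral_congr fun t ht => (he t ?_).symm
    rw [uIcc_of_le hy.1] at ht
    exact ⟨ht.1, ht.2.trans hy.2⟩
  exact this.congr hF' (hF' x hx)

/-- Since the momentum is a continuous, strictly increasing bijection in `r'` and equals a
continuous function almost everywhere, `r'` has a continuous version, for which the Euler-Lagrange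
equation holds in differentiated form. -/
theorem IsProfile.exists_continuous_deriv (hκ : 0 < κ)
    (hh : IsVolumetricEnergy h) (hp : IsProfile lam r g) {a c : ℝ} (ha : a ∈ Ioo (0 : ℝ) 1)
    (hi : IntegrableOn (fun R => force n κ h R (r R) (g R)) (Ioo a 1))
    (hEL : ∀ᵐ R ∂volume.restrict (Ioo a 1), momentum n κ h R (r R) (g R) =
        c + ∫ t in a..R, force n κ h t (r t) (g t)) :
    ∃ Q : ℝ → ℝ, ContinuousOn Q (Icc a 1) ∧ ∀ R ∈ Icc a 1, 0 < Q R ∧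
      HasDerivWithinAt r (Q R) (Icc a 1) R ∧
      HasDerivWithinAt (fun ρ => momentum n κ h ρ (r ρ) (Q ρ)) (force n κ h R (r R) (Q R))
        (Icc a 1) R := by
  have hsub : Ioo a 1 ⊆ Ioo 0 1 := Ioo_subset_Ioo_left ha.1.le
  have hU : ∀ x ∈ Icc a 1, 0 < x := fun x hx => ha.1.trans_le hx.1
  have hrc : ContinuousOn r (Icc a 1) := hp.continuousOn.mono (Icc_subset_Icc_left ha.1.le)
  have hr0 : ∀ x ∈ Icc a 1, 0 < r x := fun x hx => hp.pos ⟨ha.1.trans_le hx.1, hx.2⟩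
  set P : ℝ → ℝ := fun R => ∫ t in a..R, force n κ h t (r t) (g t) with hPdef
  have hPc : ContinuousOn P (Icc a 1) := by
    have := (intervalIntegrable_of_integrableOn_Ioo ha.2.le
      hi).absolutelyContinuousOnInterval_intervalIntegral (c := a) left_mem_uIcc |>.continuousOn
    rwa [uIcc_of_le ha.2.le] at this
  have hex : ∀ R : ℝ, ∃ q : ℝ, R ∈ Icc a 1 → 0 < q ∧ momentum n κ h R (r R) q = c + P R := by
    intro R
    by_cases hR : R ∈ Icc a 1
    · obtain ⟨q, hq, hqe⟩ := exists_momentum_eq (n := n) hκ hh (hU R hR) (hr0 R hR) (c + P R)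
      exact ⟨q, fun _ => ⟨hq, hqe⟩⟩
    · exact ⟨0, fun h => absurd h hR⟩
  choose Q hQ using hex
  have hQ0 : ∀ R ∈ Icc a 1, 0 < Q R := fun R hR => (hQ R hR).1
  have hmono : ∀ R ∈ Icc a 1, StrictMonoOn (momentum n κ h R (r R)) (Ioi 0) := fun R hR =>
    strictMonoOn_momentum hκ hh (hU R hR) (hr0 R hR)
  have hconst : ∀ q > 0, ContinuousOn (fun R => momentum n κ h R (r R) q) (Icc a 1) := fun q hq =>
    (continuousOn_momentum_comp hh hU hrc hr0 continuousOn_const fun _ _ => hq).1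
  -- `Q` is caught between constants by comparing momenta
  have hQc : ContinuousOn Q (Icc a 1) := by
    intro R hR
    have hbR := (continuousOn_const (c := c)).add hPc R hR
    refine tendsto_order.2 ⟨fun u hu => ?_, fun u hu => ?_⟩
    · rcases le_or_gt u 0 with hu0 | hu0
      · filter_upwards [self_mem_nhdsWithin] with x hx
        exact hu0.trans_lt (hQ0 x hx)
      · have hlt : momentum n κ h R (r R) u < c + P R := by
          rw [← (hQ R hR).2]; exact hmono R hR hu0 (hQ0 R hR) hu
        filter_upwards [(hconst u hu0 R hR).eventually_lt hbR hlt, self_mem_nhdsWithin]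
          with x hx hxm
        change _ < c + P x at hx
        rw [← (hQ x hxm).2] at hx
        exact ((hmono x hxm).lt_iff_lt hu0 (hQ0 x hxm)).1 hx
    · have hu0 : 0 < u := (hQ0 R hR).trans hu
      have hlt : c + P R < momentum n κ h R (r R) u := by
        rw [← (hQ R hR).2]; exact hmono R hR (hQ0 R hR) hu0 hu
      filter_upwards [Filter.Tendsto.eventually_lt hbR (hconst u hu0 R hR) hlt,
        self_mem_nhdsWithin] with x hx hxm
      change c + P x < _ at hx
      rw [← (hQ x hxm).2] at hx
      exact ((hmono x hxm).lt_iff_lt (hQ0 x hxm) hu0).1 hx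
  have hgQ : ∀ᵐ R, R ∈ Ioo a 1 → g R = Q R := by
    refine (ae_restrict_iff' measurableSet_Ioo).1 ?_
    filter_upwards [hEL, ae_restrict_of_ae_restrict_of_subset hsub hp.ae_pos,
      ae_restrict_mem measurableSet_Ioo] with R hR hg hRm
    have hRm' := Ioo_subset_Icc_self hRm
    exact (hmono R hRm').injOn hg (hQ0 R hRm') (hR.trans (hQ R hRm').2.symm)
  have hgQ' : ∀ x ∈ Icc a 1, ∀ᵐ t, t ∈ uIoc a x → g t = Q t := by
    intro x hx
    have h1 : ∀ᵐ t : ℝ, t ≠ 1 := by simp [ae_iff]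
    filter_upwards [hgQ, h1] with t ht ht1 htx
    rw [uIoc_of_le hx.1] at htx
    exact ht ⟨htx.1, lt_of_le_of_ne (htx.2.trans hx.2) ht1⟩
  have hforce := (continuousOn_momentum_comp (n := n) (κ := κ) hh hU hrc hr0 hQc hQ0).2
  have hd1 := hasDerivWithinAt_of_eq_integral (F := r) ha.2.le hQc fun x hx => by
    have e := hp.sub_eq_integral (x := a) (y := x) ⟨ha.1.le, ha.2.le⟩ ⟨ha.1.le.trans hx.1, hx.2⟩
    rw [intervalIntegral.integral_congr_ae (hgQ' x hx)] at e
    linarith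
  have hd2 := hasDerivWithinAt_of_eq_integral
    (F := fun ρ => momentum n κ h ρ (r ρ) (Q ρ)) ha.2.le hforce fun x hx => by
      have haa : a ∈ Icc a 1 := ⟨le_rfl, ha.2.le⟩
      have hPa : P a = 0 := by simp [hPdef]
      simp only [(hQ x hx).2, (hQ a haa).2, hPa, add_zero]
      rw [hPdef, add_right_inj]
      refine intervalIntegral.integral_congr_ae ((hgQ' x hx).mono fun t ht htx => ?_)
      rw [ht htx]
  exact ⟨Q, hQc, fun R hR => ⟨hQ0 R hR, hd1 R hR, hd2 R hR⟩⟩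

/-! ### The stress and the radial equilibrium equation -/

theorem partialDeriv_storedEnergy (hh : IsVolumetricEnergy h) (v : Fin n → ℝ) (i : Fin n)
    (hv : 0 < ∏ j, v j) :
    partialDeriv (storedEnergy n κ h) i v =
      κ * v i ^ (n - 1) + deriv h (∏ j, v j) * ∏ j ∈ Finset.univ.erase i, v j := by
  have hn0 : (n : ℝ) ≠ 0 := by
    have := i.pos
    positivity
  have hsum : ∀ t, ∑ j, Function.update v i t j ^ n =
      t ^ n + ∑ j ∈ Finset.univ.erase i, v j ^ n := fun t => by
    rw [← Finset.add_sum_erase _ _ (Finset.mem_univ i), Function.update_self]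
    congr 1
    exact Finset.sum_congr rfl fun j hj => by
      rw [Function.update_of_ne (Finset.ne_of_mem_erase hj)]
  have hprod : ∀ t, ∏ j, Function.update v i t j =
      t * ∏ j ∈ Finset.univ.erase i, v j := fun t => by
    rw [← Finset.mul_prod_erase _ _ (Finset.mem_univ i), Function.update_self]
    congr 1
    exact Finset.prod_congr rfl fun j hj => by
      rw [Function.update_of_ne (Finset.ne_of_mem_erase hj)]
  have he : v i * ∏ j ∈ Finset.univ.erase i, v j = ∏ j, v j :=
    Finset.mul_prod_erase _ _ (Finset.mem_univ i)
  unfold partialDeriv storedEnergy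
  simp only [hsum, hprod]
  have h1 := (((hasDerivAt_pow n (v i)).add_const
    (∑ j ∈ Finset.univ.erase i, v j ^ n)).const_mul (κ / n))
  have h2 := (hasDerivAt_id (v i)).mul_const (∏ j ∈ Finset.univ.erase i, v j)
  have h3 : HasDerivAt h (deriv h (∏ j, v j)) (id (v i) * ∏ j ∈ Finset.univ.erase i, v j) := by
    rw [id, he]; exact hh.hasDerivAt hv
  refine (h1.add (h3.comp (v i) h2)).deriv.trans ?_
  field_simp

theorem prod_radialStretches (hn : 2 ≤ n) (q t : ℝ) :
    ∏ j, radialStretches n q t j = q * t ^ (n - 1) := by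
  obtain ⟨m, rfl⟩ := Nat.exists_eq_add_of_le' hn
  rw [Fin.prod_univ_succ]
  simp [radialStretches]

theorem partialDeriv_radial_zero (hn : 2 ≤ n) (hh : IsVolumetricEnergy h) {q t : ℝ} (hq : 0 < q)
    (ht : 0 < t) :
    partialDeriv (storedEnergy n κ h) ⟨0, by omega⟩ (radialStretches n q t) =
      κ * q ^ (n - 1) + deriv h (q * t ^ (n - 1)) * t ^ (n - 1) := by
  have hp := prod_radialStretches hn q t
  rw [partialDeriv_storedEnergy hh _ _ (by rw [hp]; positivity), hp]
  have he := Finset.mul_prod_erase Finset.univ (radialStretches n q t)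
    (Finset.mem_univ ⟨0, by omega⟩)
  have h0 : radialStretches n q t ⟨0, by omega⟩ = q := by simp [radialStretches]
  rw [hp, h0] at he
  rw [h0, mul_left_cancel₀ hq.ne' he]

theorem partialDeriv_radial_one (hn : 2 ≤ n) (hh : IsVolumetricEnergy h) {q t : ℝ} (hq : 0 < q)
    (ht : 0 < t) :
    partialDeriv (storedEnergy n κ h) ⟨1, by omega⟩ (radialStretches n q t) =
      κ * t ^ (n - 1) + deriv h (q * t ^ (n - 1)) * (q * t ^ (n - 2)) := by
  have hp := prod_radialStretches hn q t
  rw [partialDeriv_storedEnergy hh _ _ (by rw [hp]; positivity), hp]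
  have he := Finset.mul_prod_erase Finset.univ (radialStretches n q t)
    (Finset.mem_univ ⟨1, by omega⟩)
  have h1 : radialStretches n q t ⟨1, by omega⟩ = t := by simp [radialStretches]
  have e : q * t ^ (n - 1) = t * (q * t ^ (n - 2)) := by
    rw [show n - 1 = n - 2 + 1 by omega, pow_succ]; ring
  rw [hp, h1, e] at he
  rw [h1, mul_left_cancel₀ ht.ne' he]

/-- The modified density is `R^{n-1} Φ` plus the null Lagrangian
`d/dR [κ (n-1)/n · r^n log (r/R)]`. Accordingly the radial stress is the momentum minus the
contribution of the null Lagrangian. -/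
theorem pow_mul_partialDeriv_radial_zero (hn : 2 ≤ n) (hh : IsVolumetricEnergy h) {R s q : ℝ}
    (hR : 0 < R) (hs : 0 < s) (hq : 0 < q) :
    R ^ (n - 1) * partialDeriv (storedEnergy n κ h) ⟨0, by omega⟩ (radialStretches n q (s / R)) =
      momentum n κ h R s q - κ * ((n : ℝ) - 1) * s ^ (n - 1) * (1 / n + Real.log (s / R)) := by
  have e : R ^ (n - 1) * (s / R) ^ (n - 1) = s ^ (n - 1) := by
    rw [← mul_pow, mul_div_cancel₀ _ hR.ne']
  rw [partialDeriv_radial_zero hn hh hq (div_pos hs hR), momentum]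
  linear_combination deriv h (q * (s / R) ^ (n - 1)) * e

/-- The derivative along `r` of the null Lagrangian's contribution to the momentum. -/
theorem hasDerivWithinAt_nullLagrangian (hn : 2 ≤ n) {q R : ℝ} {U : Set ℝ} (hR : 0 < R)
    (hr0 : 0 < r R) (hr : HasDerivWithinAt r q U R) :
    HasDerivWithinAt (fun ρ => κ * ((n : ℝ) - 1) * r ρ ^ (n - 1) * (1 / n + Real.log (r ρ / ρ)))
      (κ * ((n : ℝ) - 1) * (((n : ℝ) - 1) * r R ^ (n - 2) * q * (1 / n + Real.log (r R / R))
        + r R ^ (n - 2) * q - r R ^ (n - 1) / R)) U R := by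
  obtain ⟨m, rfl⟩ := Nat.exists_eq_add_of_le' hn
  have h1 := (hr.div (hasDerivWithinAt_id R U) hR.ne').log (div_pos hr0 hR).ne'
  have h2 := ((hr.pow (m + 1)).const_mul (κ * (((m + 2 : ℕ) : ℝ) - 1))).mul
    (h1.const_add (1 / ((m + 2 : ℕ) : ℝ)))
  refine h2.congr_deriv ?_
  simp only [show m + 2 - 1 = m + 1 by omega, Nat.add_sub_cancel, id, Pi.pow_apply, Pi.div_apply]
  push_cast
  field_simp
  ring

theorem isRadialEquilibrium_of_hasDerivWithinAt (hn : 2 ≤ n) (hh : IsVolumetricEnergy h)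
    (hr0 : ∀ R ∈ Ioc (0 : ℝ) 1, 0 < r R) (hq0 : ∀ R ∈ Ioc (0 : ℝ) 1, 0 < rDeriv r R)
    (hd : DifferentiableOn ℝ r (Ioc 0 1)) (hqc : ContinuousOn (rDeriv r) (Ioc 0 1))
    (hm : ∀ R ∈ Ioc (0 : ℝ) 1, HasDerivWithinAt (fun ρ => momentum n κ h ρ (r ρ) (rDeriv r ρ))
      (force n κ h R (r R) (rDeriv r R)) (Ioc 0 1) R) :
    IsRadialEquilibrium hn (storedEnergy n κ h) r := by
  have hU : UniqueDiffOn ℝ (Ioc (0 : ℝ) 1) := uniqueDiffOn_Ioc 0 1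
  have hrd : ∀ R ∈ Ioc (0 : ℝ) 1, HasDerivWithinAt r (rDeriv r R) (Ioc 0 1) R := fun R hR =>
    (hd R hR).hasDerivWithinAt
  -- differentiate the stress as momentum minus null Lagrangian part
  have hflux : ∀ R ∈ Ioc (0 : ℝ) 1,
      HasDerivWithinAt (fun ρ => ρ ^ (n - 1) * radialPartial (storedEnergy n κ h) r ⟨0, by omega⟩ ρ)
        (((n : ℝ) - 1) * R ^ (n - 2) * radialPartial (storedEnergy n κ h) r ⟨1, by omega⟩ R)
        (Ioc 0 1) R := by
    intro R hR
    have e : ∀ ρ ∈ Ioc (0 : ℝ) 1,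
        ρ ^ (n - 1) * radialPartial (storedEnergy n κ h) r ⟨0, by omega⟩ ρ =
        momentum n κ h ρ (r ρ) (rDeriv r ρ)
          - κ * ((n : ℝ) - 1) * r ρ ^ (n - 1) * (1 / n + Real.log (r ρ / ρ)) := fun ρ hρ =>
      pow_mul_partialDeriv_radial_zero hn hh hρ.1 (hr0 ρ hρ) (hq0 ρ hρ)
    refine (((hm R hR).sub (hasDerivWithinAt_nullLagrangian hn hR.1 (hr0 R hR)
      (hrd R hR))).congr e (e R hR)).congr_deriv ?_
    have hR0 := hR.1
    have hs := hr0 R hR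
    rw [radialPartial, partialDeriv_radial_one hn hh (hq0 R hR) (div_pos hs hR0), force]
    set d := deriv h (rDeriv r R * (r R / R) ^ (n - 1))
    have e1 : R ^ (n - 2) * (r R / R) ^ (n - 2) = r R ^ (n - 2) := by
      rw [← mul_pow, mul_div_cancel₀ _ hR0.ne']
    have e2 : R ^ (n - 2) * (r R / R) ^ (n - 1) = r R ^ (n - 1) / R := by
      rw [show n - 1 = n - 2 + 1 by omega, pow_succ, ← mul_assoc, e1, pow_succ]
      ring
    linear_combination (-(((n : ℝ) - 1) * d * rDeriv r R)) * e1 - (((n : ℝ) - 1) * κ) * e2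
  refine ⟨?_, hr0, hq0, ?_, fun R hR => ?_⟩
  · exact (contDiffOn_one_iff_derivWithin hU).2 ⟨hd, hqc⟩
  · refine (contDiffOn_one_iff_derivWithin hU).2
      ⟨fun R hR => (hflux R hR).differentiableWithinAt, ?_⟩
    have hc : ContinuousOn (fun R => ((n : ℝ) - 1) * R ^ (n - 2) *
        (κ * (r R / R) ^ (n - 1) + deriv h (rDeriv r R * (r R / R) ^ (n - 1)) *
          (rDeriv r R * (r R / R) ^ (n - 2)))) (Ioc 0 1) := by
      have h1 : ContinuousOn (fun R => r R / R) (Ioc 0 1) :=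
        hd.continuousOn.div continuousOn_id fun R hR => hR.1.ne'
      have h2 : ContinuousOn (fun R => deriv h (rDeriv r R * (r R / R) ^ (n - 1))) (Ioc 0 1) :=
        hh.continuousOn_deriv.comp (hqc.mul (h1.pow _)) fun R hR =>
          mul_pos (hq0 R hR) (pow_pos (div_pos (hr0 R hR) hR.1) _)
      exact (continuousOn_const.mul (continuousOn_id.pow _)).mul
        ((continuousOn_const.mul (h1.pow _)).add (h2.mul (hqc.mul (h1.pow _))))
    refine hc.congr fun R hR => ?_
    rw [(hflux R hR).derivWithin (hU R hR), radialPartial,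
      partialDeriv_radial_one hn hh (hq0 R hR) (div_pos (hr0 R hR) hR.1)]
  · exact (hflux R (Ioo_subset_Ioc_self hR)).hasDerivAt (Ioc_mem_nhds hR.1 hR.2)

end Cavitation

theorem mainTheorem3 (n : ℕ) (hn : 2 ≤ n) (κ : ℝ) (hκ : 0 < κ) (lam : ℝ) (hlam : 0 < lam)
    (h : ℝ → ℝ) (hh : Cavitation.IsVolumetricEnergy h) (hgrowth : Cavitation.DerivGrowth h)
    (r : ℝ → ℝ) (hr : r ∈ Cavitation.Admissible lam)
    (hmin : IsMinOn (Cavitation.modifiedEnergy n κ h lam) (Cavitation.Admissible lam) r) :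
    Cavitation.IsRadialEquilibrium hn (Cavitation.storedEnergy n κ h) r := by
  have hp := Cavitation.isProfile_of_mem_admissible hr
  obtain ⟨hi, hle⟩ := Cavitation.integrableOn_and_integral_le_of_isMinOn hn hκ hlam hh hp hmin
  -- every point of `(0,1]` lies in an interval `(a,1]` on which `r'` has a continuous version
  have key : ∀ R ∈ Ioc (0 : ℝ) 1, 0 < Cavitation.rDeriv r R ∧
      DifferentiableWithinAt ℝ r (Ioc 0 1) R ∧
      ContinuousWithinAt (Cavitation.rDeriv r) (Ioc 0 1) R ∧
      HasDerivWithinAt (fun ρ => Cavitation.momentum n κ h ρ (r ρ) (Cavitation.rDeriv r ρ))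
        (Cavitation.force n κ h R (r R) (Cavitation.rDeriv r R)) (Ioc 0 1) R := by
    intro R hR
    have ha : R / 2 ∈ Ioo (0 : ℝ) 1 := ⟨half_pos hR.1, by linarith [hR.1, hR.2]⟩
    obtain ⟨hBi, c, hc⟩ := hp.exists_momentum_ae_eq hn hκ hh hgrowth hi hle ha
    obtain ⟨Q, hQc, hQ⟩ := hp.exists_continuous_deriv hκ hh ha hBi hc
    have hnhds : ∀ x ∈ Ioc (R / 2) 1, Icc (R / 2) 1 ∈ 𝓝[Ioc 0 1] x := fun x hx => by
      filter_upwards [self_mem_nhdsWithin, mem_nhdsWithin_of_mem_nhds (Ioi_mem_nhds hx.1)]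
        with y hy hy'
      exact ⟨le_of_lt hy', hy.2⟩
    have hd : ∀ x ∈ Ioc (R / 2) 1, HasDerivWithinAt r (Q x) (Ioc 0 1) x := fun x hx =>
      (hQ x (Ioc_subset_Icc_self hx)).2.1.mono_of_mem_nhdsWithin (hnhds x hx)
    have heq : ∀ x ∈ Ioc (R / 2) 1, Cavitation.rDeriv r x = Q x := fun x hx =>
      (hd x hx).derivWithin (uniqueDiffOn_Ioc 0 1 x ⟨ha.1.trans hx.1, hx.2⟩)
    have hRm : R ∈ Ioc (R / 2) 1 := ⟨half_lt_self hR.1, hR.2⟩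
    have hev : Cavitation.rDeriv r =ᶠ[𝓝[Ioc 0 1] R] Q := by
      filter_upwards [self_mem_nhdsWithin, mem_nhdsWithin_of_mem_nhds (Ioi_mem_nhds hRm.1)]
        with y hy hy'
      exact heq y ⟨hy', hy.2⟩
    have hQR := hQ R (Ioc_subset_Icc_self hRm)
    rw [heq R hRm]
    refine ⟨hQR.1, (hd R hRm).differentiableWithinAt, ?_, ?_⟩
    · exact ((hQc R (Ioc_subset_Icc_self hRm)).mono_of_mem_nhdsWithin
        (hnhds R hRm)).congr_of_eventuallyEq hev (heq R hRm)
    · refine (hQR.2.2.mono_of_mem_nhdsWithin (hnhds R hRm)).congr_of_eventuallyEq ?_ ?_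
      · filter_upwards [hev] with y hy
        rw [hy]
      · rw [heq R hRm]
  exact Cavitation.isRadialEquilibrium_of_hasDerivWithinAt hn hh (fun R hR => hp.pos hR)
    (fun R hR => (key R hR).1) (fun R hR => (key R hR).2.1) (fun R hR => (key R hR).2.2.1)
    fun R hR => (key R hR).2.2.2
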